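/- Let $F,A\in\mathbb R^{m\times n}$, $H\in\mathbb R^{p\times n}$, $\ell\in\mathbb R^m$, and let $Q\in\mathbb R^{m\times m}$, $R\in\mathbb R^{p\times p}$ be symmetric positive definite. A solution on $I$ ($I=[0,t_1]$ with $t_1>0$, or $I=[0,\infty)$) of $$\frac{d(Fx)}{dt}=Ax+f,\qquad y=Hx+\eta \tag{1}$$ is a tuple $(x,f,y,\eta)$ of $L^2_{loc}(I)$ functions such that $Fx$ is absolutely continuous, $Fx(t)=Fx(0)+\int_0^t(Ax(s)+f(s))\,ds$ for all $t\in I$, and $y=Hx+\eta$ a.e. on $I$. Likewise $(q,u)\in L^2_{loc}(I)\times L^2_{loc}(I)$ is a solution on $I$ of the dual equation $$\frac{d(F^\top q)}{dt}=A^\top q-H^\top u \tag{2}$$ if $F^\top q$ is absolutely continuous and $F^\top q(t)=F^\top q(0)+\int_0^t(A^\top q(s)-H^\top u(s))\,ds$ for all $t\in I$. (Here $x$, $q$ are $L^2_{loc}$ classes; $Fx(t)$, $F^\top q(t)$ are the values of the absolutely continuous representatives of $Fx$, $F^\top q$. Absolutely continuous on $[0,\infty)$ means on every compact subinterval.) Assume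 that $(F,A,H)$ is $\ell$-detectable: (2) has a solution on $[0,\infty)$ with $F^\top q(0)=F^\top\ell$ and $\lim_{t\to\infty}F^\top q(t)=0$. A system $\mathscr S=(A_a,B_a,C_a,D_a)$ with $N$ states, $k\ge1$ inputs and $m+p$ outputs is associated with (2) if: (a) either $k=1$, $D_a=0$, $B_a=0$, or $D_a$ has full column rank; (b) $F^\top D_s=0$ and $\operatorname{rank}F^\top C_s=N$, where $C_s,D_s$ are the first $m$ rows of $C_a,D_a$; (c) for each $I$ as above, $(q,u)$ is a solution of (2) on $I$ if and only if there are an absolutely continuous $v$ and $g\in L^2_{loc}(I)$ with $\dot v=A_av+B_ag$ and $\left[\begin{smallmatrix}q\\u\end{smallmatrix}\right]=C_av+D_ag$ a.e. on $I$. Its state map is $\mathcal M=(F^\top C_s)^+$ (Moore-Penrose pseudoinverse). Let $\mathcal V_g$ be its stabilizability subspace, i.e. the set of $v(0)$ over all trajectories $(v,g)$ on $[0,\infty)$ with $v(t)\to0$. For a basis transformation $T$ that maps $\mathcal V_g$ onto the span of the first $l$ coordinate vectors, let $A_g$ be the upper left $l\times l$ block of $TA_aT^{-1}$, $B_g$ the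 first $l$ rows of $TB_a$, $C_g$ the first $l$ columns of $C_aT^{-1}$, $D_g=D_a$, and $\mathcal M_g=[I_l\ 0]\,T\mathcal M$. Let $P=P^\top>0$ solve the Riccati equation $$0=PA_g+A_g^\top P-K^\top(D_g^\top SD_g)K+C_g^\top SC_g,\qquad S=\left[\begin{smallmatrix}Q^{-1}&0\\0&R^{-1}\end{smallmatrix}\right],$$ where $K=(D_g^\top SD_g)^{-1}(B_g^\top P+D_g^\top SC_g)$ if $D_g\ne0$ and $K=0$ if $D_g=0$. With $\hat C_u,\hat D_u$ the last $p$ rows of $C_g,D_g$, put $v^*(t)=e^{(A_g-B_gK)t}\mathcal M_gF^\top\ell$, $u^*(t)=(\hat C_u-\hat D_uK)v^*(t)$, and consider the observer $\check U(t,s)=u^*(t-s)$, $0\le s\le t$, with output $\mathscr O_{\check U}(y)(t)=\int_0^ty^\top(s)\check U(t,s)\,ds$. Then all eigenvalues of $(A_g-B_gK)^\top$ have negative real part, and for every solution $(x,f,y,\eta)$ of (1) on $[0,\infty)$ the estimation error $e(t)=\ell^\top Fx(t)-\mathscr O_{\check U}(y)(t)$ satisfies, for all $t\ge0$, $$e(t)=\ell^\top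 F\mathcal M_g^\top\,\tilde r(t),$$ where $\tilde r$ is the (existing) absolutely continuous solution on $[0,\infty)$ of $$\dot{\tilde r}(t)=(A_g-B_gK)^\top\tilde r(t)+(C_g-D_gK)^\top\left[\begin{smallmatrix}f(t)\\-\eta(t)\end{smallmatrix}\right]\ \text{a.e.},\qquad \tilde r(0)=(C_g-D_gK)^\top\left[\begin{smallmatrix}Fx(0)\\0\end{smallmatrix}\right].$$ In particular: (i) if $f=0$ and $\eta=0$ a.e., then $\lim_{t\to\infty}e(t)=0$; (ii) if $f^\top f$ and $\eta^\top\eta$ are (essentially) bounded on $[0,\infty)$, then $\sup_{t\ge0}e(t)^2<+\infty$; (iii) if $f\in L^2([0,\infty),\mathbb R^m)$ and $\eta\in L^2([0,\infty),\mathbb R^p)$, then $e\in L^2([0,\infty),\mathbb R)$. -/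

import Mathlib

open Matrix MeasureTheory Filter Set
open scoped Topology

noncomputable section

namespace DAEObserver

/-! ### Moore-Penrose pseudoinverse of a real matrix -/

/-- The four Penrose equations: `Y` is the Moore-Penrose pseudoinverse of `X`. -/
structure IsMoorePenrose {a b : Type} [Fintype a] [Fintype b]
    (X : Matrix a b ℝ) (Y : Matrix b a ℝ) : Prop where
  mul_mul_left : X * Y * X = X
  mul_mul_right : Y * X * Y = Y
  symm_left : (X * Y)ᵀ = X * Y
  symm_right : (Y * X)ᵀ = Y * X

theorem IsMoorePenrose.unique {a b : Type} [Fintype a] [Fintype b]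
    {X : Matrix a b ℝ} {Y Z : Matrix b a ℝ}
    (hY : IsMoorePenrose X Y) (hZ : IsMoorePenrose X Z) : Y = Z := by
  have h1 : X * Y = X * Z := by
    calc X * Y = (X * Y)ᵀ := hY.symm_left.symm
      _ = ((X * Z) * (X * Y))ᵀ := by rw [← Matrix.mul_assoc, hZ.mul_mul_left]
      _ = (X * Y) * (X * Z) := by rw [transpose_mul, hY.symm_left, hZ.symm_left]
      _ = X * Z := by rw [← Matrix.mul_assoc, hY.mul_mul_left]
  have h2 : Y * X = Z * X := by
    calc Y * X = (Y * X)ᵀ := hY.symm_right.symm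
      _ = ((Y * X) * (Z * X))ᵀ := by
          rw [Matrix.mul_assoc, ← Matrix.mul_assoc X, hZ.mul_mul_left]
      _ = (Z * X) * (Y * X) := by rw [transpose_mul, hY.symm_right, hZ.symm_right]
      _ = Z * X := by rw [Matrix.mul_assoc, ← Matrix.mul_assoc X, hY.mul_mul_left]
  calc Y = Y * X * Y := hY.mul_mul_right.symm
    _ = Z * (X * Y) := by rw [h2, Matrix.mul_assoc]
    _ = Z := by rw [h1, ← Matrix.mul_assoc, hZ.mul_mul_right]

theorem exists_isMoorePenrose {a b : Type} [Fintype a] [Fintype b]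
    (X : Matrix a b ℝ) : ∃ Y, IsMoorePenrose X Y := by
  classical
  have hA : (Xᵀ * X).IsHermitian := by
    simpa using isHermitian_conjTranspose_mul_self X
  obtain ⟨G, hGs, hc, h1, h2⟩ : ∃ G : Matrix b b ℝ, Gᵀ = G ∧ G * (Xᵀ * X) = (Xᵀ * X) * G ∧
      (Xᵀ * X) * G * (Xᵀ * X) = Xᵀ * X ∧ G * (Xᵀ * X) * G = G := by
    obtain ⟨φ, lam, hs⟩ : ∃ (φ : Matrix b b ℝ ≃⋆ₐ[ℝ] Matrix b b ℝ) (lam : b → ℝ),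
        Xᵀ * X = φ (diagonal lam) := ⟨_, _, hA.spectral_theorem⟩
    rw [hs]
    refine ⟨φ (diagonal fun i => (lam i)⁻¹), ?_, ?_, ?_, ?_⟩
    · have h := map_star φ (diagonal fun i => (lam i)⁻¹)
      rw [star_eq_conjTranspose, star_eq_conjTranspose, conjTranspose_eq_transpose_of_trivial,
        conjTranspose_eq_transpose_of_trivial, diagonal_transpose] at h
      exact h.symm
    all_goals
      simp only [← map_mul, diagonal_mul_diagonal]
      congr 2
      funext i
      by_cases h : lam i = 0 <;> simp [h]
  have hat : (Xᵀ * X)ᵀ = Xᵀ * X := by rw [transpose_mul, transpose_transpose]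
  have hX : X * (G * (Xᵀ * X)) = X := by
    rw [← sub_eq_zero, ← conjTranspose_mul_self_eq_zero, conjTranspose_eq_transpose_of_trivial]
    have e1 : (X * (G * (Xᵀ * X)) - X)ᵀ = (Xᵀ * X) * (G * Xᵀ) - Xᵀ := by
      rw [transpose_sub, transpose_mul, transpose_mul, hat, hGs, Matrix.mul_assoc]
    have e2 : (X * (G * (Xᵀ * X)) - X)ᵀ * X = 0 := by
      rw [e1, Matrix.sub_mul, Matrix.mul_assoc, Matrix.mul_assoc G, ← Matrix.mul_assoc _ G, h1,
        sub_self]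
    rw [Matrix.mul_sub, e2, ← Matrix.mul_assoc, e2, Matrix.zero_mul, sub_zero]
  refine ⟨G * Xᵀ, ?_, ?_, ?_, ?_⟩
  · rw [Matrix.mul_assoc, Matrix.mul_assoc, hX]
  · rw [Matrix.mul_assoc G, ← Matrix.mul_assoc, h2]
  · simp only [transpose_mul, transpose_transpose, hGs, Matrix.mul_assoc]
  · rw [Matrix.mul_assoc, transpose_mul, hat, hGs, hc]

/-- The Moore-Penrose pseudoinverse `X⁺`. -/
def pinv {a b : Type} [Fintype a] [Fintype b] (X : Matrix a b ℝ) : Matrix b a ℝ :=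
  (exists_isMoorePenrose X).choose

theorem pinv_spec {a b : Type} [Fintype a] [Fintype b] (X : Matrix a b ℝ) :
    IsMoorePenrose X (pinv X) :=
  (exists_isMoorePenrose X).choose_spec

/-! ### Function spaces on time intervals -/

/-- A time interval: `[0, ∞)` or `[0, t₁]` with `t₁ > 0`. -/
def IsTimeInterval (I : Set ℝ) : Prop :=
  I = Ici 0 ∨ ∃ t₁ : ℝ, 0 < t₁ ∧ I = Icc 0 t₁

/-- `f ∈ L²_loc(I)`: `f` is square integrable on every compact subinterval of `I`. -/
def L2Loc {d : ℕ} (I : Set ℝ) (f : ℝ → Fin d → ℝ) : Prop :=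
  ∀ a b : ℝ, Icc a b ⊆ I → MemLp f 2 (volume.restrict (Icc a b))

/-- `z ∈ AC(I)`: `z` is absolutely continuous on every compact subinterval of `I`. -/
def ACOn {d : ℕ} (I : Set ℝ) (z : ℝ → Fin d → ℝ) : Prop :=
  ∀ a b : ℝ, a ≤ b → Icc a b ⊆ I → AbsolutelyContinuousOnInterval z a b

/-! ### Differential-algebraic equations -/

/-- `x` solves `d(E x)/dt = M x + w` on `I`. As `x` is determined only almost everywhere, so is
`E x`; the function `z` is the absolutely continuous representative of `E x` on `I`. It is the
function which the notation `E x(t)` refers to, for every single `t ∈ I`. -/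
structure SolvesDAE {a b : ℕ} (I : Set ℝ) (E M : Matrix (Fin a) (Fin b) ℝ)
    (x : ℝ → Fin b → ℝ) (w : ℝ → Fin a → ℝ) (z : ℝ → Fin a → ℝ) : Prop where
  ac : ACOn I z
  ae_eq : ∀ᵐ t ∂volume.restrict I, E *ᵥ x t = z t
  integral_eq : ∀ t ∈ I, z t = z 0 + ∫ s in (0 : ℝ)..t, (M *ᵥ x s + w s)

/-- `(x, f, y, η)` is a solution of `d(F x)/dt = A x + f`, `y = H x + η` on `I`, where `Fx` is the
absolutely continuous representative of `F x`. -/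
structure IsSolution {m n p : ℕ} (I : Set ℝ) (F A : Matrix (Fin m) (Fin n) ℝ)
    (H : Matrix (Fin p) (Fin n) ℝ) (x : ℝ → Fin n → ℝ) (f : ℝ → Fin m → ℝ)
    (y η : ℝ → Fin p → ℝ) (Fx : ℝ → Fin m → ℝ) : Prop where
  l2_x : L2Loc I x
  l2_f : L2Loc I f
  l2_y : L2Loc I y
  l2_η : L2Loc I η
  state : SolvesDAE I F A x f Fx
  output : ∀ᵐ t ∂volume.restrict I, y t = H *ᵥ x t + η t

/-- `(q, u)` is a solution on `I` of the dual equation `d(Fᵀ q)/dt = Aᵀ q - Hᵀ u`, where `Fq` is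
the absolutely continuous representative of `Fᵀ q`. -/
structure IsDualSolution {m n p : ℕ} (I : Set ℝ) (F A : Matrix (Fin m) (Fin n) ℝ)
    (H : Matrix (Fin p) (Fin n) ℝ) (q : ℝ → Fin m → ℝ) (u : ℝ → Fin p → ℝ)
    (Fq : ℝ → Fin n → ℝ) : Prop where
  l2_q : L2Loc I q
  l2_u : L2Loc I u
  state : SolvesDAE I Fᵀ Aᵀ q (fun t => -(Hᵀ *ᵥ u t)) Fq

/-- `(F, A, H)` is `ℓ`-detectable: the dual equation has a solution on `[0, ∞)` with
`Fᵀ q(0) = Fᵀ ℓ` and `Fᵀ q(t) → 0` as `t → ∞`. -/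
def IsDetectable {m n p : ℕ} (F A : Matrix (Fin m) (Fin n) ℝ) (H : Matrix (Fin p) (Fin n) ℝ)
    (ℓ : Fin m → ℝ) : Prop :=
  ∃ (q : ℝ → Fin m → ℝ) (u : ℝ → Fin p → ℝ) (Fq : ℝ → Fin n → ℝ),
    IsDualSolution (Ici 0) F A H q u Fq ∧ Fq 0 = Fᵀ *ᵥ ℓ ∧ Tendsto Fq atTop (𝓝 0)

/-! ### Linear time invariant systems associated with the dual equation -/

/-- A tuple `(A, B, C, D)`: the system `v' = A v + B g`, `(q, u) = C v + D g`, with `N` states,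
`k` inputs and `m + p` outputs, of which the first `m` are `q` and the last `p` are `u`. -/
structure LTI (N k m p : ℕ) where
  A : Matrix (Fin N) (Fin N) ℝ
  B : Matrix (Fin N) (Fin k) ℝ
  C : Matrix (Fin m ⊕ Fin p) (Fin N) ℝ
  D : Matrix (Fin m ⊕ Fin p) (Fin k) ℝ

/-- `v ∈ AC(I)` and `v' = M v + w` almost everywhere on `I`. -/
def SolvesODE {N : ℕ} (I : Set ℝ) (M : Matrix (Fin N) (Fin N) ℝ) (w v : ℝ → Fin N → ℝ) : Prop :=
  ACOn I v ∧ ∀ᵐ t ∂volume.restrict I, HasDerivAt v (M *ᵥ v t + w t) t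

/-- `v ∈ AC(I)`, `g ∈ L²_loc(I)` and `v' = A v + B g` almost everywhere on `I`. -/
def LTI.IsTrajectory {N k m p : ℕ} (S : LTI N k m p) (I : Set ℝ)
    (v : ℝ → Fin N → ℝ) (g : ℝ → Fin k → ℝ) : Prop :=
  L2Loc I g ∧ SolvesODE I S.A (fun t => S.B *ᵥ g t) v

/-- The system `S` is associated with the dual equation of `(F, A, H)`. -/
structure IsAssociated {m n p N k : ℕ} (F A : Matrix (Fin m) (Fin n) ℝ)
    (H : Matrix (Fin p) (Fin n) ℝ) (S : LTI N k m p) : Prop where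
  inputs_pos : 0 < k
  input_rank : (k = 1 ∧ S.D = 0 ∧ S.B = 0) ∨ S.D.rank = k
  direct_eq : Fᵀ * S.D.toRows₁ = 0
  state_rank : (Fᵀ * S.C.toRows₁).rank = N
  behavior : ∀ I : Set ℝ, IsTimeInterval I → ∀ (q : ℝ → Fin m → ℝ) (u : ℝ → Fin p → ℝ),
    (∃ Fq, IsDualSolution I F A H q u Fq) ↔
      ∃ (v : ℝ → Fin N → ℝ) (g : ℝ → Fin k → ℝ), S.IsTrajectory I v g ∧
        ∀ᵐ t ∂volume.restrict I, Sum.elim (q t) (u t) = S.C *ᵥ v t + S.D *ᵥ g t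

/-- The state map `(Fᵀ C_s)⁺` of `S`, with `C_s` the first `m` rows of `C`. -/
def LTI.stateMap {m n p N k : ℕ} (F : Matrix (Fin m) (Fin n) ℝ) (S : LTI N k m p) :
    Matrix (Fin N) (Fin n) ℝ :=
  pinv (Fᵀ * S.C.toRows₁)

/-- The stabilizability subspace: the initial states which some input steers to zero. -/
def LTI.stabilizabilitySubspace {m p N k : ℕ} (S : LTI N k m p) : Set (Fin N → ℝ) :=
  {v₀ | ∃ (v : ℝ → Fin N → ℝ) (g : ℝ → Fin k → ℝ),
    S.IsTrajectory (Ici 0) v g ∧ v 0 = v₀ ∧ Tendsto v atTop (𝓝 0)}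

/-- `T` is an invertible change of coordinates with inverse `T'` that maps the stabilizability
subspace of `S` onto the span of the first `l` coordinate vectors. -/
structure LTI.IsAdaptedBasis {m p N k l r : ℕ} (S : LTI N k m p)
    (T : Matrix (Fin l ⊕ Fin r) (Fin N) ℝ) (T' : Matrix (Fin N) (Fin l ⊕ Fin r) ℝ) : Prop where
  mul_inv : T * T' = 1
  inv_mul : T' * T = 1
  mem_iff : ∀ v, v ∈ S.stabilizabilitySubspace ↔ ∀ j : Fin r, (T *ᵥ v) (Sum.inr j) = 0

/-- The first `l` states of `S` in the coordinates given by `T`. -/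
def LTI.restrict {m p N k l r : ℕ} (S : LTI N k m p)
    (T : Matrix (Fin l ⊕ Fin r) (Fin N) ℝ) (T' : Matrix (Fin N) (Fin l ⊕ Fin r) ℝ) :
    LTI l k m p where
  A := (T * S.A * T').toBlocks₁₁
  B := (T * S.B).toRows₁
  C := (S.C * T').toCols₁
  D := S.D

/-- `Sg` is a stabilizable system associated with the dual equation of `(F, A, H)`, and `Mg` is its
state map: `Sg` is the restriction of an associated system `S` to its stabilizability subspace, and
`Mg = [I 0] T M` with `M` the state map of `S`. -/
def IsStabilizableAssociated {m n p k l : ℕ} (F A : Matrix (Fin m) (Fin n) ℝ)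
    (H : Matrix (Fin p) (Fin n) ℝ) (Sg : LTI l k m p) (Mg : Matrix (Fin l) (Fin n) ℝ) : Prop :=
  ∃ (N r : ℕ) (S : LTI N k m p) (T : Matrix (Fin l ⊕ Fin r) (Fin N) ℝ)
    (T' : Matrix (Fin N) (Fin l ⊕ Fin r) ℝ),
    IsAssociated F A H S ∧ S.IsAdaptedBasis T T' ∧
      Sg = S.restrict T T' ∧ Mg = (T * S.stateMap F).toRows₁

/-! ### Riccati equation and observer -/

/-- `S = diag(Q⁻¹, R⁻¹)`. -/
def weight {m p : ℕ} (Q : Matrix (Fin m) (Fin m) ℝ) (R : Matrix (Fin p) (Fin p) ℝ) :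
    Matrix (Fin m ⊕ Fin p) (Fin m ⊕ Fin p) ℝ :=
  fromBlocks Q⁻¹ 0 0 R⁻¹

open Classical in
/-- The gain `K = (Dᵀ S D)⁻¹ (Bᵀ P + Dᵀ S C)` if `D ≠ 0`, and `K = 0` if `D = 0`. -/
def gain {m p k l : ℕ} (Sg : LTI l k m p) (Q : Matrix (Fin m) (Fin m) ℝ)
    (R : Matrix (Fin p) (Fin p) ℝ) (P : Matrix (Fin l) (Fin l) ℝ) : Matrix (Fin k) (Fin l) ℝ :=
  if Sg.D = 0 then 0
  else (Sg.Dᵀ * weight Q R * Sg.D)⁻¹ * (Sg.Bᵀ * P + Sg.Dᵀ * weight Q R * Sg.C)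

/-- The algebraic Riccati equation `0 = P A + Aᵀ P - Kᵀ (Dᵀ S D) K + Cᵀ S C`. -/
def SolvesARE {m p k l : ℕ} (Sg : LTI l k m p) (Q : Matrix (Fin m) (Fin m) ℝ)
    (R : Matrix (Fin p) (Fin p) ℝ) (P : Matrix (Fin l) (Fin l) ℝ) : Prop :=
  0 = P * Sg.A + Sg.Aᵀ * P
      - (gain Sg Q R P)ᵀ * (Sg.Dᵀ * weight Q R * Sg.D) * gain Sg Q R P
      + Sg.Cᵀ * weight Q R * Sg.C

/-- The closed loop matrix `A - B K`. -/
def closedLoopA {m p k l : ℕ} (Sg : LTI l k m p) (K : Matrix (Fin k) (Fin l) ℝ) :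
    Matrix (Fin l) (Fin l) ℝ :=
  Sg.A - Sg.B * K

/-- The closed loop output matrix `C - D K`. -/
def closedLoopC {m p k l : ℕ} (Sg : LTI l k m p) (K : Matrix (Fin k) (Fin l) ℝ) :
    Matrix (Fin m ⊕ Fin p) (Fin l) ℝ :=
  Sg.C - Sg.D * K

/-- The solution `v*(t) = exp(t (A - B K)) v₀` of `v' = (A - B K) v`, `v(0) = v₀ = Mg Fᵀ ℓ`. -/
def dualState {m n p k l : ℕ} (F : Matrix (Fin m) (Fin n) ℝ) (Sg : LTI l k m p)
    (Mg : Matrix (Fin l) (Fin n) ℝ) (K : Matrix (Fin k) (Fin l) ℝ) (ℓ : Fin m → ℝ)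
    (t : ℝ) : Fin l → ℝ :=
  NormedSpace.exp (t • closedLoopA Sg K) *ᵥ (Mg *ᵥ (Fᵀ *ᵥ ℓ))

/-- The observer `U(t, s) = u*(t - s)`, where `u*(t) = (C_u - D_u K) v*(t)` and `C_u`, `D_u` are
the last `p` rows of `C` and `D`. -/
def observer {m n p k l : ℕ} (F : Matrix (Fin m) (Fin n) ℝ) (Sg : LTI l k m p)
    (Mg : Matrix (Fin l) (Fin n) ℝ) (K : Matrix (Fin k) (Fin l) ℝ) (ℓ : Fin m → ℝ)
    (t s : ℝ) : Fin p → ℝ :=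
  (Sg.C.toRows₂ - Sg.D.toRows₂ * K) *ᵥ dualState F Sg Mg K ℓ (t - s)

/-- The output `∫₀ᵗ y(s)ᵀ U(t, s) ds` of the observer `U`. -/
def observerOutput {p : ℕ} (U : ℝ → ℝ → Fin p → ℝ) (y : ℝ → Fin p → ℝ) (t : ℝ) : ℝ :=
  ∫ s in (0 : ℝ)..t, y s ⬝ᵥ U t s

/-- The estimation error `ℓᵀ F x(t) - ∫₀ᵗ y(s)ᵀ U(t, s) ds`. -/
def estimationError {m p : ℕ} (ℓ : Fin m → ℝ) (U : ℝ → ℝ → Fin p → ℝ)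
    (Fx : ℝ → Fin m → ℝ) (y : ℝ → Fin p → ℝ) (t : ℝ) : ℝ :=
  ℓ ⬝ᵥ Fx t - observerOutput U y t

/-- All complex eigenvalues of the real matrix `M` have negative real part. -/
def IsHurwitz {l : ℕ} (M : Matrix (Fin l) (Fin l) ℝ) : Prop :=
  ∀ μ ∈ spectrum ℂ (M.map (algebraMap ℝ ℂ)), μ.re < 0

/-- `r̃` solves the error equation on `[0, ∞)`:
`r̃' = (A - B K)ᵀ r̃ + (C - D K)ᵀ [f; -η]`, `r̃(0) = (C - D K)ᵀ [F x(0); 0]`. -/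
def SolvesErrorEquation {m p k l : ℕ} (Sg : LTI l k m p) (K : Matrix (Fin k) (Fin l) ℝ)
    (Fx f : ℝ → Fin m → ℝ) (η : ℝ → Fin p → ℝ) (r : ℝ → Fin l → ℝ) : Prop :=
  SolvesODE (Ici 0) (closedLoopA Sg K)ᵀ
      (fun t => (closedLoopC Sg K)ᵀ *ᵥ Sum.elim (f t) (-η t)) r ∧
    r 0 = (closedLoopC Sg K)ᵀ *ᵥ Sum.elim (Fx 0) 0

end DAEObserver

end

noncomputable section

namespace DAEObserver

/-! ### Absolutely continuous functions -/

/-! Write $M=A_g-B_gK$, $C=C_g-D_gK$ with row blocks $C_1,C_2$, $w_0=\mathcal M_gF^\top\ell$, and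
$J$ for the basis matrix of $\mathcal V_g$. Two facts carry the proof: a duality identity and a
Lyapunov function.

Duality. $\mathcal V_g$ contains the range of $B_a$ and is $A_a$-invariant, so closed loop
trajectories lift through $J$ to trajectories of the associated system and solve (2).
Differentiating at time $0$ turns this into $F^\top C_1M=A^\top C_1-H^\top C_2$
(`LTI.IsRestriction.closedLoop_dual_eq`). Consequently $d=C_1^\top Fx-\tilde r$ satisfies $\dot
d=M^\top d+C_2^\top y$, $d(0)=0$: it is driven by the output alone. Pairing $d(s)$ with
$e^{(t-s)M}w_0$ and integrating shows that the observer output is $w_0\cdot d(t)$. Detectability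
gives $F^\top C_1w_0=F^\top\ell$ (`IsAssociated.stateMap_mem`), hence $w_0\cdot C_1^\top
Fx(t)=\ell\cdot Fx(t)$, and $e=w_0\cdot\tilde r$ follows (`estimationError_eq`).

Stability. Completing the square in the Riccati equation gives $PM+M^\top P=-C^\top SC$
(`closedLoop_lyapunov_eq`). Since $F^\top C_1=F^\top C_sJ$ is injective, so is $C$; the right side
is therefore negative definite and $P^{-1}$ defines a strict Lyapunov function for $M^\top$
(`isLyapunov_of_lyapunov_eq`). The Hurwitz property and (i)-(iii) are read off from this function,
the last three through `IsLyapunov.exists_decay`. -/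

theorem ac_congr {E : Type*} [PseudoMetricSpace E] {z w : ℝ → E} {a b : ℝ}
    (hz : AbsolutelyContinuousOnInterval z a b) (h : ∀ t ∈ uIcc a b, w t = z t) :
    AbsolutelyContinuousOnInterval w a b := by
  rw [absolutelyContinuousOnInterval_iff] at hz ⊢
  intro ε hε
  obtain ⟨δ, hδ, H⟩ := hz ε hε
  refine ⟨δ, hδ, fun E hE hl => ?_⟩
  convert H E hE hl using 1
  refine Finset.sum_congr rfl fun i hi => ?_
  rw [h _ (hE.1 i hi).1, h _ (hE.1 i hi).2]

theorem ac_apply {d : ℕ} {z : ℝ → Fin d → ℝ} {a b : ℝ}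
    (hz : AbsolutelyContinuousOnInterval z a b) (i : Fin d) :
    AbsolutelyContinuousOnInterval (fun t => z t i) a b := by
  rw [absolutelyContinuousOnInterval_iff] at hz ⊢
  intro ε hε
  obtain ⟨δ, hδ, H⟩ := hz ε hε
  refine ⟨δ, hδ, fun E hE hl => lt_of_le_of_lt ?_ (H E hE hl)⟩
  exact Finset.sum_le_sum fun j _ => dist_le_pi_dist _ _ i

theorem ac_const {E : Type*} [NormedAddCommGroup E] [NormedSpace ℝ E] (c : E) (a b : ℝ) :
    AbsolutelyContinuousOnInterval (fun _ : ℝ => c) a b :=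
  contDiffOn_const.absolutelyContinuousOnInterval

theorem ac_sum {E ι : Type*} [NormedAddCommGroup E] [NormedSpace ℝ E] (s : Finset ι)
    {z : ι → ℝ → E} {a b : ℝ}
    (hz : ∀ i ∈ s, AbsolutelyContinuousOnInterval (z i) a b) :
    AbsolutelyContinuousOnInterval (fun t => ∑ i ∈ s, z i t) a b := by
  classical
  induction s using Finset.induction_on with
  | empty => simpa using ac_const (0 : E) a b
  | insert i s hi ih =>
    simp only [Finset.sum_insert hi]
    exact (hz i (Finset.mem_insert_self _ _)).add
      (ih fun j hj => hz j (Finset.mem_insert_of_mem hj))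

theorem ac_pi {d : ℕ} {z : ℝ → Fin d → ℝ} {a b : ℝ}
    (hz : ∀ i, AbsolutelyContinuousOnInterval (fun t => z t i) a b) :
    AbsolutelyContinuousOnInterval z a b := by
  have h : z = fun t => ∑ i, z t i • (Pi.single i (1 : ℝ) : Fin d → ℝ) := by
    funext t j
    simp [Finset.sum_apply, Pi.single_apply]
  rw [h]
  exact ac_sum _ fun i _ => (hz i).smul (ac_const _ a b)

theorem ac_dotProduct {d : ℕ} {z w : ℝ → Fin d → ℝ} {a b : ℝ}
    (hz : AbsolutelyContinuousOnInterval z a b) (hw : AbsolutelyContinuousOnInterval w a b) :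
    AbsolutelyContinuousOnInterval (fun t => z t ⬝ᵥ w t) a b :=
  ac_sum _ fun i _ => (ac_apply hz i).mul (ac_apply hw i)

theorem ac_mulVec {d e : ℕ} (M : Matrix (Fin e) (Fin d) ℝ) {z : ℝ → Fin d → ℝ} {a b : ℝ}
    (hz : AbsolutelyContinuousOnInterval z a b) :
    AbsolutelyContinuousOnInterval (fun t => M *ᵥ z t) a b :=
  ac_pi fun i => ac_dotProduct (ac_const (M i) a b) hz

theorem ac_comp_add {E : Type*} [PseudoMetricSpace E] {z : ℝ → E} {a b τ : ℝ}
    (hz : AbsolutelyContinuousOnInterval z (a + τ) (b + τ)) :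
    AbsolutelyContinuousOnInterval (fun t => z (t + τ)) a b := by
  rw [absolutelyContinuousOnInterval_iff] at hz ⊢
  intro ε hε
  obtain ⟨δ, hδ, H⟩ := hz ε hε
  refine ⟨δ, hδ, fun E hE hl => ?_⟩
  have key : ∀ x y t : ℝ, t ∈ uIoc (x + τ) (y + τ) → t - τ ∈ uIoc x y := by
    intro x y t ht
    rw [mem_uIoc] at ht ⊢
    rcases ht with ⟨h1, h2⟩ | ⟨h1, h2⟩
    · left; constructor <;> linarith
    · right; constructor <;> linarith
  have key2 : ∀ x : ℝ, x ∈ uIcc a b → x + τ ∈ uIcc (a + τ) (b + τ) := by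
    intro x hx
    rw [mem_uIcc] at hx ⊢
    rcases hx with ⟨h1, h2⟩ | ⟨h1, h2⟩
    · left; constructor <;> linarith
    · right; constructor <;> linarith
  refine H (E.1, fun i => ((E.2 i).1 + τ, (E.2 i).2 + τ)) ⟨fun i hi => ?_, ?_⟩ ?_
  · exact ⟨key2 _ (hE.1 i hi).1, key2 _ (hE.1 i hi).2⟩
  · intro i hi j hj hij
    have h := hE.2 hi hj hij
    simp only [Function.onFun, Set.disjoint_left] at h ⊢
    exact fun t h1 h2 => h (key _ _ _ h1) (key _ _ _ h2)
  · simpa using hl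

theorem ACOn.continuousOn {d : ℕ} {z : ℝ → Fin d → ℝ} (hz : ACOn (Ici 0) z) :
    ContinuousOn z (Ici 0) := by
  intro t ht
  have ht : 0 ≤ t := ht
  have h := (hz 0 (t + 1) (by linarith) Icc_subset_Ici_self).continuousOn
  rw [uIcc_of_le (by linarith)] at h
  refine (h t ⟨ht, by linarith⟩).mono_of_mem_nhdsWithin ?_
  rw [← Ici_inter_Iic]
  exact inter_mem_nhdsWithin _ (Iic_mem_nhds (by linarith))

theorem acOn_of_contDiff {d : ℕ} {z : ℝ → Fin d → ℝ} (hz : ContDiff ℝ 1 z) (I : Set ℝ) :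
    ACOn I z :=
  fun _ _ _ _ => hz.contDiffOn.absolutelyContinuousOnInterval

/-- The fundamental theorem of calculus for absolutely continuous functions. -/
theorem integral_eq_sub_of_ac {φ ψ : ℝ → ℝ} {t : ℝ} (ht : 0 ≤ t)
    (hφ : AbsolutelyContinuousOnInterval φ 0 t)
    (h : ∀ᵐ s ∂volume.restrict (Ici 0), HasDerivAt φ (ψ s) s) :
    IntervalIntegrable ψ volume 0 t ∧ ∫ s in (0 : ℝ)..t, ψ s = φ t - φ 0 := by
  have h' : ∀ᵐ s ∂volume.restrict (uIoc 0 t), deriv φ s = ψ s := by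
    rw [uIoc_of_le ht]
    refine ae_mono (Measure.restrict_mono
      (fun s hs => (le_of_lt hs.1 : (0 : ℝ) ≤ s)) le_rfl) (h.mono fun s hs => hs.deriv)
  refine ⟨hφ.intervalIntegrable_deriv.congr_ae h', ?_⟩
  rw [← hφ.integral_deriv_eq_sub]
  refine (intervalIntegral.integral_congr_ae ?_).symm
  rwa [ae_restrict_iff' measurableSet_uIoc] at h'

/-! ### Derivatives of products -/

theorem hasDerivAt_dotProduct {ι : Type*} [Fintype ι] {u w : ℝ → ι → ℝ} {u' w' : ι → ℝ} {t : ℝ}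
    (hu : HasDerivAt u u' t) (hw : HasDerivAt w w' t) :
    HasDerivAt (fun s => u s ⬝ᵥ w s) (u' ⬝ᵥ w t + u t ⬝ᵥ w') t := by
  rw [hasDerivAt_pi] at hu hw
  simp only [dotProduct, ← Finset.sum_add_distrib]
  exact HasDerivAt.fun_sum fun i _ => (hu i).mul (hw i)

theorem hasDerivAt_mulVec {ι κ : Type*} [Fintype ι] [Fintype κ] {E : ℝ → Matrix ι κ ℝ}
    {E' : Matrix ι κ ℝ} {w : ℝ → κ → ℝ} {w' : κ → ℝ} {t : ℝ}
    (hE : ∀ i j, HasDerivAt (fun s => E s i j) (E' i j) t) (hw : HasDerivAt w w' t) :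
    HasDerivAt (fun s => E s *ᵥ w s) (E' *ᵥ w t + E t *ᵥ w') t := by
  rw [hasDerivAt_pi]
  intro i
  exact hasDerivAt_dotProduct (u := fun s => E s i) (u' := E' i)
    (hasDerivAt_pi.2 fun j => hE i j) hw

theorem hasDerivAt_const_mulVec {ι κ : Type*} [Fintype ι] [Fintype κ] (M : Matrix ι κ ℝ)
    {w : ℝ → κ → ℝ} {w' : κ → ℝ} {t : ℝ} (hw : HasDerivAt w w' t) :
    HasDerivAt (fun s => M *ᵥ w s) (M *ᵥ w') t := by
  simpa using hasDerivAt_mulVec (E := fun _ => M) (E' := 0)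
    (fun i j => by simpa using hasDerivAt_const t (M i j)) hw

/-! ### The matrix exponential -/

section MatrixExp

attribute [local instance] Matrix.linftyOpNormedRing Matrix.linftyOpNormedAlgebra

theorem hasDerivAt_matrix_exp {d : ℕ} (M : Matrix (Fin d) (Fin d) ℝ) (t : ℝ) (i j : Fin d) :
    HasDerivAt (fun s : ℝ => NormedSpace.exp (s • M) i j)
      ((M * NormedSpace.exp (t • M)) i j) t := by
  have h := hasDerivAt_exp_smul_const' (𝕂 := ℝ) M t
  have e : HasDerivAt (fun s : ℝ => (Matrix.entryLinearMap ℝ ℝ i j).toContinuousLinearMap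
      (NormedSpace.exp (s • M))) _ t :=
    ((Matrix.entryLinearMap ℝ ℝ i j).toContinuousLinearMap.hasFDerivAt.comp_hasDerivAt t h)
  exact e

theorem matrix_exp_neg_mul {d : ℕ} (M : Matrix (Fin d) (Fin d) ℝ) (t : ℝ) :
    NormedSpace.exp (t • M) * NormedSpace.exp (-t • M) = 1 := by
  rw [← Matrix.exp_add_of_commute]
  · simp
  · rw [neg_smul]; exact (Commute.refl _).neg_right

end MatrixExp

theorem continuous_matrix_exp {d : ℕ} (M : Matrix (Fin d) (Fin d) ℝ) :
    Continuous fun t : ℝ => NormedSpace.exp (t • M) :=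
  continuous_matrix fun i j => continuous_iff_continuousAt.2 fun t =>
    (hasDerivAt_matrix_exp M t i j).continuousAt

theorem hasDerivAt_exp_mulVec {d : ℕ} (M : Matrix (Fin d) (Fin d) ℝ) (c : Fin d → ℝ) (t : ℝ) :
    HasDerivAt (fun s : ℝ => NormedSpace.exp (s • M) *ᵥ c)
      (M *ᵥ (NormedSpace.exp (t • M) *ᵥ c)) t := by
  have h := hasDerivAt_mulVec (hasDerivAt_matrix_exp M t) (hasDerivAt_const t c)
  rwa [mulVec_zero, add_zero, ← mulVec_mulVec] at h

theorem contDiff_of_hasDerivAt_mulVec {d : ℕ} {M : Matrix (Fin d) (Fin d) ℝ}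
    {v : ℝ → Fin d → ℝ} (h : ∀ t, HasDerivAt v (M *ᵥ v t) t) : ContDiff ℝ 1 v := by
  have hc : Continuous v := continuous_iff_continuousAt.2 fun t => (h t).continuousAt
  rw [contDiff_one_iff_deriv]
  refine ⟨fun t => (h t).differentiableAt, ?_⟩
  rw [funext fun t => (h t).deriv]
  fun_prop

theorem contDiff_exp_mulVec {d : ℕ} (M : Matrix (Fin d) (Fin d) ℝ) (c : Fin d → ℝ) :
    ContDiff ℝ 1 fun s : ℝ => NormedSpace.exp (s • M) *ᵥ c :=
  contDiff_of_hasDerivAt_mulVec (hasDerivAt_exp_mulVec M c)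

/-! ### Locally square integrable functions -/

theorem memLp_mulVec {ι κ : Type*} [Fintype ι] [Fintype κ] {μ : Measure ℝ} {q : ENNReal}
    (M : Matrix ι κ ℝ) {f : ℝ → κ → ℝ} (hf : MemLp f q μ) : MemLp (fun t => M *ᵥ f t) q μ :=
  (M.mulVecLin.toContinuousLinearMap).comp_memLp' hf

theorem memLp_pi_iff {ι : Type*} [Fintype ι] {μ : Measure ℝ} {q : ENNReal}
    {f : ℝ → ι → ℝ} : MemLp f q μ ↔ ∀ i, MemLp (fun t => f t i) q μ := by
  classical
  constructor
  · intro h i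
    exact (ContinuousLinearMap.proj (R := ℝ) (φ := fun _ : ι => ℝ) i).comp_memLp' h
  · intro h
    have e : f = fun t => ∑ i, f t i • (Pi.single i (1 : ℝ) : ι → ℝ) := by
      funext t j
      simp [Finset.sum_apply, Pi.single_apply]
    rw [e]
    refine memLp_finsetSum _ fun i _ => ?_
    exact ((ContinuousLinearMap.id ℝ ℝ).smulRight
      (Pi.single i (1 : ℝ) : ι → ℝ)).comp_memLp' (h i)

theorem L2Loc.mulVec {d e : ℕ} {I : Set ℝ} {f : ℝ → Fin d → ℝ} (hf : L2Loc I f)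
    (M : Matrix (Fin e) (Fin d) ℝ) : L2Loc I (fun t => M *ᵥ f t) :=
  fun a b h => memLp_mulVec M (hf a b h)

theorem L2Loc.add {d : ℕ} {I : Set ℝ} {f g : ℝ → Fin d → ℝ} (hf : L2Loc I f) (hg : L2Loc I g) :
    L2Loc I (fun t => f t + g t) :=
  fun a b h => (hf a b h).add (hg a b h)

theorem L2Loc.intervalIntegrable {d : ℕ} {f : ℝ → Fin d → ℝ} (hf : L2Loc (Ici 0) f) {t : ℝ}
    (ht : 0 ≤ t) : IntervalIntegrable f volume 0 t := by
  rw [intervalIntegrable_iff_integrableOn_Icc_of_le ht]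
  exact (hf 0 t Icc_subset_Ici_self).integrable (by norm_num)

theorem l2Loc_of_continuous {d : ℕ} {f : ℝ → Fin d → ℝ} (hf : Continuous f) (I : Set ℝ) :
    L2Loc I f := fun a b _ =>
  (memLp_top_of_bound (C := (isCompact_Icc.exists_bound_of_continuousOn
      hf.continuousOn (s := Icc a b)).choose) hf.aestronglyMeasurable
    ((ae_restrict_iff' measurableSet_Icc).2 (ae_of_all _ (isCompact_Icc.exists_bound_of_continuousOn
      hf.continuousOn (s := Icc a b)).choose_spec))).mono_exponent le_top

theorem intervalIntegrable_pi {d : ℕ} {f : ℝ → Fin d → ℝ} {a b : ℝ}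
    (h : ∀ i, IntervalIntegrable (fun t => f t i) volume a b) :
    IntervalIntegrable f volume a b :=
  ⟨Integrable.of_eval fun i => (h i).1, Integrable.of_eval fun i => (h i).2⟩

theorem intervalIntegrable_apply {d : ℕ} {f : ℝ → Fin d → ℝ} {a b : ℝ}
    (h : IntervalIntegrable f volume a b) (i : Fin d) :
    IntervalIntegrable (fun t => f t i) volume a b :=
  ⟨h.1.eval i, h.2.eval i⟩

theorem intervalIntegral_apply {d : ℕ} {f : ℝ → Fin d → ℝ} {a b : ℝ}
    (h : IntervalIntegrable f volume a b) (i : Fin d) :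
    (∫ t in a..b, f t) i = ∫ t in a..b, f t i :=
  ((ContinuousLinearMap.proj (R := ℝ) (φ := fun _ : Fin d => ℝ) i).intervalIntegral_comp_comm
    h).symm

theorem dotProduct_intervalIntegral {d : ℕ} (c : Fin d → ℝ) {f : ℝ → Fin d → ℝ} {a b : ℝ}
    (h : IntervalIntegrable f volume a b) :
    c ⬝ᵥ (∫ t in a..b, f t) = ∫ t in a..b, c ⬝ᵥ f t := by
  simp only [dotProduct]
  rw [intervalIntegral.integral_finsetSum fun i _ => (intervalIntegrable_apply h i).const_mul _]
  simp only [intervalIntegral_apply h, intervalIntegral.integral_const_mul]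

/-! ### Integral functions and variation of constants -/

theorem ac_integral {d : ℕ} {f : ℝ → Fin d → ℝ}
    (hf : ∀ t, 0 ≤ t → IntervalIntegrable f volume 0 t) :
    ACOn (Ici 0) fun t => ∫ s in (0 : ℝ)..t, f s := by
  intro a b hab hI
  have ha : 0 ≤ a := hI ⟨le_rfl, hab⟩
  have hb : 0 ≤ b := ha.trans hab
  refine AbsolutelyContinuousOnInterval.mono (a := 0) (b := b) ?_ (by
    rw [uIcc_of_le hab, uIcc_of_le hb]; exact Icc_subset_Icc_left ha)
  refine ac_pi fun i => ac_congr ((intervalIntegrable_apply (hf b hb)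
    i).absolutelyContinuousOnInterval_intervalIntegral (c := 0) left_mem_uIcc) fun t ht => ?_
  rw [uIcc_of_le hb] at ht
  exact intervalIntegral_apply (hf t ht.1) i

theorem ae_hasDerivAt_integral {d : ℕ} {f : ℝ → Fin d → ℝ}
    (hf : ∀ t, 0 ≤ t → IntervalIntegrable f volume 0 t) :
    ∀ᵐ t ∂volume.restrict (Ici 0), HasDerivAt (fun t => ∫ s in (0 : ℝ)..t, f s) (f t) t := by
  rw [ae_restrict_iff' measurableSet_Ici]
  -- Exhausting the half line by the intervals $[0,n]$ leaves only countably many null sets to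
  -- discard.
  have h : ∀ n : ℕ, ∀ᵐ t, t ∈ uIcc (0 : ℝ) n → HasDerivAt (fun t => ∫ s in (0 : ℝ)..t, f s)
      (f t) t := fun n => by
    filter_upwards [(hf n n.cast_nonneg).ae_hasDerivAt_integral] with t ht h
    exact ht h 0 left_mem_uIcc
  filter_upwards [ae_all_iff.2 h] with t ht h0
  obtain ⟨n, hn⟩ := exists_nat_ge t
  exact ht n (by rw [uIcc_of_le n.cast_nonneg]; exact ⟨h0, hn⟩)

theorem intervalIntegrable_exp_mulVec {d : ℕ} (M : Matrix (Fin d) (Fin d) ℝ)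
    {w : ℝ → Fin d → ℝ} (hw : ∀ t, 0 ≤ t → IntervalIntegrable w volume 0 t) {t : ℝ} (ht : 0 ≤ t) :
    IntervalIntegrable (fun s => NormedSpace.exp (-s • M) *ᵥ w s) volume 0 t := by
  refine intervalIntegrable_pi fun i => ?_
  have h : ∀ j ∈ Finset.univ, IntervalIntegrable
      (fun s => (NormedSpace.exp (-s • M) : Matrix (Fin d) (Fin d) ℝ) i j * w s j) volume 0 t :=
    fun j _ => (intervalIntegrable_apply (hw t ht) j).continuousOn_mul
      (((continuous_matrix_exp M).comp continuous_neg).matrix_elem i j).continuousOn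
  have e : (fun s => (NormedSpace.exp (-s • M) *ᵥ w s) i) =
      ∑ j, fun s => (NormedSpace.exp (-s • M) : Matrix (Fin d) (Fin d) ℝ) i j * w s j := by
    funext s
    simp [Matrix.mulVec, dotProduct]
  rw [e]
  exact IntervalIntegrable.sum _ h

/-- The variation of constants formula. -/
def variationOfConstants {d : ℕ} (M : Matrix (Fin d) (Fin d) ℝ) (w : ℝ → Fin d → ℝ)
    (v₀ : Fin d → ℝ) (t : ℝ) : Fin d → ℝ :=
  NormedSpace.exp (t • M) *ᵥ (v₀ + ∫ s in (0 : ℝ)..t, NormedSpace.exp (-s • M) *ᵥ w s)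

theorem variationOfConstants_zero {d : ℕ} (M : Matrix (Fin d) (Fin d) ℝ) (w : ℝ → Fin d → ℝ)
    (v₀ : Fin d → ℝ) : variationOfConstants M w v₀ 0 = v₀ := by
  simp [variationOfConstants]

theorem solvesODE_variationOfConstants {d : ℕ} (M : Matrix (Fin d) (Fin d) ℝ)
    {w : ℝ → Fin d → ℝ} (hw : ∀ t, 0 ≤ t → IntervalIntegrable w volume 0 t) (v₀ : Fin d → ℝ) :
    SolvesODE (Ici 0) M w (variationOfConstants M w v₀) := by
  have hi := fun t ht => intervalIntegrable_exp_mulVec M hw (t := t) ht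
  constructor
  · intro a b hab hI
    have h1 := ac_integral hi a b hab hI
    have hE : ∀ i, AbsolutelyContinuousOnInterval
        (fun t : ℝ => (NormedSpace.exp (t • M) : Matrix (Fin d) (Fin d) ℝ) i) a b := by
      refine fun i => ac_pi fun j => ?_
      have := (contDiff_pi.1 (contDiff_exp_mulVec M (Pi.single j 1)) i)
      simp only [mulVec_single_one] at this
      exact this.contDiffOn.absolutelyContinuousOnInterval
    exact ac_pi fun i => ac_dotProduct (hE i) ((ac_const v₀ a b).add h1)
  · filter_upwards [ae_hasDerivAt_integral hi] with t ht
    have h := hasDerivAt_mulVec (hasDerivAt_matrix_exp M t) (ht.const_add v₀)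
    rwa [← mulVec_mulVec, mulVec_mulVec (w t), matrix_exp_neg_mul, one_mulVec] at h

/-! ### Quadratic forms -/

theorem dotProduct_self_nonneg' {ι : Type*} [Fintype ι] (v : ι → ℝ) : 0 ≤ v ⬝ᵥ v :=
  Finset.sum_nonneg fun i _ => mul_self_nonneg (v i)

theorem dotProduct_self_pos {ι : Type*} [Fintype ι] {v : ι → ℝ} (hv : v ≠ 0) : 0 < v ⬝ᵥ v :=
  (dotProduct_self_nonneg' v).lt_of_ne' fun h => hv (dotProduct_self_eq_zero.1 h)

theorem dotProduct_mulVec_comm {ι κ : Type*} [Fintype ι] [Fintype κ] (M : Matrix ι κ ℝ)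
    (v : ι → ℝ) (w : κ → ℝ) : v ⬝ᵥ M *ᵥ w = Mᵀ *ᵥ v ⬝ᵥ w := by
  rw [dotProduct_mulVec, mulVec_transpose]

/-- The constant is the minimum of the form on the Euclidean unit sphere, attained by compactness;
homogeneity does the rest. The sphere is cut out by the dot product because the norm of `ι → ℝ` is
the supremum norm. -/
theorem exists_le_dotProduct_mulVec {ι : Type*} [Fintype ι] (N : Matrix ι ι ℝ) :
    ∃ c : ℝ, (∀ v, c * (v ⬝ᵥ v) ≤ v ⬝ᵥ N *ᵥ v) ∧
      ((∀ v, v ≠ 0 → 0 < v ⬝ᵥ N *ᵥ v) → 0 < c) := by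
  have hcont : Continuous fun v : ι → ℝ => v ⬝ᵥ N *ᵥ v := by fun_prop
  have hcont' : Continuous fun v : ι → ℝ => v ⬝ᵥ v := by fun_prop
  have hK : IsCompact {v : ι → ℝ | v ⬝ᵥ v = 1} := by
    refine Metric.isCompact_of_isClosed_isBounded (isClosed_eq hcont' continuous_const) ?_
    refine (Metric.isBounded_closedBall (x := (0 : ι → ℝ)) (r := 1)).subset fun v hv => ?_
    rw [mem_closedBall_zero_iff, pi_norm_le_iff_of_nonneg zero_le_one]
    intro i
    have h : v i * v i ≤ v ⬝ᵥ v :=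
      Finset.single_le_sum (f := fun i => v i * v i) (fun j _ => mul_self_nonneg (v j))
        (Finset.mem_univ i)
    rw [Real.norm_eq_abs, abs_le_one_iff_mul_self_le_one]
    exact h.trans_eq hv
  have hscale : ∀ v : ι → ℝ, v ≠ 0 →
      ((Real.sqrt (v ⬝ᵥ v))⁻¹ • v) ∈ {v : ι → ℝ | v ⬝ᵥ v = 1} ∧
      v ⬝ᵥ N *ᵥ v = ((Real.sqrt (v ⬝ᵥ v))⁻¹ • v) ⬝ᵥ N *ᵥ ((Real.sqrt (v ⬝ᵥ v))⁻¹ • v) *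
        (v ⬝ᵥ v) := by
    intro v hv
    have h0 := dotProduct_self_pos hv
    have h1 : (Real.sqrt (v ⬝ᵥ v))⁻¹ * (Real.sqrt (v ⬝ᵥ v))⁻¹ = (v ⬝ᵥ v)⁻¹ := by
      rw [← mul_inv, Real.mul_self_sqrt h0.le]
    simp only [mem_ofPred_eq, mulVec_smul, smul_dotProduct, dotProduct_smul, smul_eq_mul,
      ← mul_assoc, h1]
    refine ⟨inv_mul_cancel₀ h0.ne', ?_⟩
    field_simp
  -- The sphere is empty only in dimension zero, where any positive constant serves.
  rcases {v : ι → ℝ | v ⬝ᵥ v = 1}.eq_empty_or_nonempty with he | hne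
  · refine ⟨1, fun v => ?_, fun _ => one_pos⟩
    rcases eq_or_ne v 0 with rfl | hv
    · simp
    · have := (hscale v hv).1
      rw [he] at this
      exact this.elim
  · obtain ⟨v₀, hv₀, hmin⟩ := hK.exists_isMinOn hne hcont.continuousOn
    refine ⟨v₀ ⬝ᵥ N *ᵥ v₀, fun v => ?_, fun h => h _ ?_⟩
    · rcases eq_or_ne v 0 with rfl | hv
      · simp
      · obtain ⟨h1, h2⟩ := hscale v hv
        rw [h2]
        exact mul_le_mul_of_nonneg_right (hmin h1) (dotProduct_self_nonneg' v)
    · rintro rfl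
      simp at hv₀

theorem exists_dotProduct_mulVec_le {ι : Type*} [Fintype ι] (N : Matrix ι ι ℝ) :
    ∃ c : ℝ, 0 < c ∧ ∀ v, v ⬝ᵥ N *ᵥ v ≤ c * (v ⬝ᵥ v) := by
  obtain ⟨c, hc, -⟩ := exists_le_dotProduct_mulVec (-N)
  refine ⟨max (-c) 1, by positivity, fun v => ?_⟩
  have h := hc v
  rw [neg_mulVec, dotProduct_neg] at h
  have := mul_le_mul_of_nonneg_right (le_max_left (-c) 1) (dotProduct_self_nonneg' v)
  linarith

theorem exists_mulVec_dotProduct_self_le {ι κ : Type*} [Fintype ι] [Fintype κ]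
    (N : Matrix κ ι ℝ) : ∃ c : ℝ, 0 < c ∧ ∀ v, N *ᵥ v ⬝ᵥ N *ᵥ v ≤ c * (v ⬝ᵥ v) := by
  obtain ⟨c, hc, h⟩ := exists_dotProduct_mulVec_le (Nᵀ * N)
  refine ⟨c, hc, fun v => ?_⟩
  have := h v
  rwa [← mulVec_mulVec, dotProduct_mulVec_comm, transpose_transpose] at this

theorem dotProduct_sq_le {ι : Type*} [Fintype ι] (v w : ι → ℝ) :
    (v ⬝ᵥ w) ^ 2 ≤ (v ⬝ᵥ v) * (w ⬝ᵥ w) := by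
  have := Finset.sum_mul_sq_le_sq_mul_sq Finset.univ v w
  simpa only [dotProduct, ← sq] using this

theorem dotProduct_mulVec_symm {ι : Type*} [Fintype ι] {X : Matrix ι ι ℝ} (hX : X.PosDef)
    (v w : ι → ℝ) : v ⬝ᵥ X *ᵥ w = w ⬝ᵥ X *ᵥ v := by
  have h : Xᵀ = X := by simpa using hX.isHermitian.eq
  rw [dotProduct_mulVec_comm, h, dotProduct_comm]

theorem PosDef.dotProduct_pos {ι : Type*} [Fintype ι] {X : Matrix ι ι ℝ} (hX : X.PosDef)
    {v : ι → ℝ} (hv : v ≠ 0) : 0 < v ⬝ᵥ X *ᵥ v := by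
  simpa using hX.dotProduct_mulVec_pos hv

theorem posDef_of_dotProduct_pos {ι : Type*} [Fintype ι] {X : Matrix ι ι ℝ} (hs : Xᵀ = X)
    (h : ∀ v, v ≠ 0 → 0 < v ⬝ᵥ X *ᵥ v) : X.PosDef :=
  .of_dotProduct_mulVec_pos (by simpa [IsHermitian] using hs) fun v hv => by simpa using h v hv

theorem weight_posDef {m p : ℕ} {Q : Matrix (Fin m) (Fin m) ℝ} {R : Matrix (Fin p) (Fin p) ℝ}
    (hQ : Q.PosDef) (hR : R.PosDef) : (weight Q R).PosDef := by
  have hQ' := hQ.inv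
  have hR' := hR.inv
  refine posDef_of_dotProduct_pos ?_ fun v hv => ?_
  · have h1 : Q⁻¹ᵀ = Q⁻¹ := by simpa using hQ'.isHermitian.eq
    have h2 : R⁻¹ᵀ = R⁻¹ := by simpa using hR'.isHermitian.eq
    simp only [weight, fromBlocks_transpose, h1, h2, transpose_zero]
  · have e : v ⬝ᵥ weight Q R *ᵥ v = (v ∘ Sum.inl) ⬝ᵥ Q⁻¹ *ᵥ (v ∘ Sum.inl) +
        (v ∘ Sum.inr) ⬝ᵥ R⁻¹ *ᵥ (v ∘ Sum.inr) := by
      rw [weight, fromBlocks_mulVec]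
      simp [dotProduct, Fintype.sum_sum_type]
    rw [e]
    by_cases h : v ∘ Sum.inl = 0
    · have h' : v ∘ Sum.inr ≠ 0 := by
        intro h'
        apply hv
        funext i
        rcases i with i | i
        · exact congrFun h i
        · exact congrFun h' i
      simpa [h] using PosDef.dotProduct_pos hR' h'
    · refine add_pos_of_pos_of_nonneg (PosDef.dotProduct_pos hQ' h) ?_
      simpa using hR'.posSemidef.dotProduct_mulVec_nonneg (v ∘ Sum.inr)

/-! ### Lyapunov functions -/

/-- The quadratic form of `X` is a strict Lyapunov function of `v' = M v`. -/
structure IsLyapunov {d : ℕ} (X M : Matrix (Fin d) (Fin d) ℝ) : Prop where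
  posDef : X.PosDef
  neg : ∀ v, v ≠ 0 → v ⬝ᵥ X *ᵥ (M *ᵥ v) < 0

/-- For a complex eigenvector $a+ib$, adding $a\cdot XMa$ and $b\cdot XMb$ cancels the terms in the
imaginary part of $\mu$ by symmetry of $X$, leaving $\operatorname{Re}\mu\,(a\cdot Xa+b\cdot Xb)<0$.
-/
theorem IsLyapunov.isHurwitz {d : ℕ} {X M : Matrix (Fin d) (Fin d) ℝ} (h : IsLyapunov X M) :
    IsHurwitz M := by
  intro μ hμ
  rw [← Matrix.spectrum_toLin', ← Module.End.hasEigenvalue_iff_mem_spectrum] at hμ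
  obtain ⟨z, hz⟩ := hμ.exists_hasEigenvector
  have hz0 := hz.2
  have hMz : (M.map (algebraMap ℝ ℂ)) *ᵥ z = μ • z := by simpa using hz.apply_eq_smul
  set a : Fin d → ℝ := fun i => (z i).re with ha
  set b : Fin d → ℝ := fun i => (z i).im with hb
  have hMa : M *ᵥ a = μ.re • a - μ.im • b := by
    funext i
    have := congrArg Complex.re (congrFun hMz i)
    simpa [mulVec, dotProduct, ha, hb] using this
  have hMb : M *ᵥ b = μ.im • a + μ.re • b := by
    funext i
    have := congrArg Complex.im (congrFun hMz i)
    simp [mulVec, dotProduct, ha, hb] at this ⊢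
    linarith
  have hab : a ≠ 0 ∨ b ≠ 0 := by
    by_contra! hc
    refine hz0 (funext fun i => Complex.ext ?_ ?_)
    · exact congrFun hc.1 i
    · exact congrFun hc.2 i
  have nonneg : ∀ v, 0 ≤ v ⬝ᵥ X *ᵥ v := fun v => by
    simpa using h.posDef.posSemidef.dotProduct_mulVec_nonneg v
  have nonpos : ∀ v, v ⬝ᵥ X *ᵥ (M *ᵥ v) ≤ 0 := fun v => by
    rcases eq_or_ne v 0 with rfl | hv
    · simp
    · exact (h.neg v hv).le
  have e : a ⬝ᵥ X *ᵥ (M *ᵥ a) + b ⬝ᵥ X *ᵥ (M *ᵥ b) =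
      μ.re * (a ⬝ᵥ X *ᵥ a + b ⬝ᵥ X *ᵥ b) := by
    rw [hMa, hMb]
    simp only [mulVec_sub, mulVec_add, mulVec_smul, dotProduct_sub, dotProduct_add,
      dotProduct_smul, smul_eq_mul]
    rw [dotProduct_mulVec_symm h.posDef b a]
    ring
  have hlt : μ.re * (a ⬝ᵥ X *ᵥ a + b ⬝ᵥ X *ᵥ b) < 0 := by
    rw [← e]
    rcases hab with h' | h'
    · linarith [h.neg a h', nonpos b]
    · linarith [h.neg b h', nonpos a]
  by_contra! hc
  exact absurd (mul_nonneg hc (add_nonneg (nonneg a) (nonneg b))) hlt.not_ge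

theorem integrable_dotProduct_self {ι : Type*} [Fintype ι] {μ : Measure ℝ} {f : ℝ → ι → ℝ}
    (hf : MemLp f 2 μ) : Integrable (fun t => f t ⬝ᵥ f t) μ := by
  refine integrable_finsetSum _ fun i _ => ?_
  have := (memLp_pi_iff.1 hf i).integrable_sq
  simpa only [sq] using this

theorem L2Loc.intervalIntegrable_dotProduct_self {d : ℕ} {f : ℝ → Fin d → ℝ}
    (hf : L2Loc (Ici 0) f) {t : ℝ} (ht : 0 ≤ t) :
    IntervalIntegrable (fun s => f s ⬝ᵥ f s) volume 0 t := by
  rw [intervalIntegrable_iff_integrableOn_Icc_of_le ht]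
  exact integrable_dotProduct_self (hf 0 t Icc_subset_Ici_self)

/-- For $V=r\cdot Xr$, Young's inequality gives $\dot V\le-\alpha V+c\,|b|^2$. Integrating
$(e^{\alpha t}V)'$ yields the pointwise estimate, used for decay and boundedness; integrating $\dot
V$ itself yields the estimate for $L^2$ forcing. -/
theorem IsLyapunov.exists_decay {d : ℕ} {X M : Matrix (Fin d) (Fin d) ℝ} (h : IsLyapunov X M) :
    ∃ α c : ℝ, 0 < α ∧ 0 < c ∧ ∀ b r : ℝ → Fin d → ℝ, L2Loc (Ici 0) b →
      SolvesODE (Ici 0) M b r → ∀ t, 0 ≤ t →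
        Real.exp (α * t) * (r t ⬝ᵥ X *ᵥ r t) ≤
          r 0 ⬝ᵥ X *ᵥ r 0 + c * ∫ s in (0 : ℝ)..t, Real.exp (α * s) * (b s ⬝ᵥ b s) ∧
        α * ∫ s in (0 : ℝ)..t, r s ⬝ᵥ X *ᵥ r s ≤
          r 0 ⬝ᵥ X *ᵥ r 0 + c * ∫ s in (0 : ℝ)..t, b s ⬝ᵥ b s := by
  obtain ⟨w, hw, hw'⟩ := exists_le_dotProduct_mulVec (-(X * M))
  have hw0 : 0 < w := hw' fun v hv => by
    rw [neg_mulVec, dotProduct_neg, ← mulVec_mulVec]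
    exact neg_pos.2 (h.neg v hv)
  obtain ⟨x₁, hx₁, hX₁⟩ := exists_dotProduct_mulVec_le X
  obtain ⟨x₂, hx₂, hX₂⟩ := exists_mulVec_dotProduct_self_le X
  have young : ∀ v u : Fin d → ℝ, 2 * (v ⬝ᵥ X *ᵥ (M *ᵥ v + u)) ≤
      -(w / x₁) * (v ⬝ᵥ X *ᵥ v) + x₂ / w * (u ⬝ᵥ u) := by
    intro v u
    have h1 := hw v
    rw [neg_mulVec, dotProduct_neg, ← mulVec_mulVec] at h1
    -- The cross term may cost $w|v|^2$, half of the dissipation $2w|v|^2$; the other half dominates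
    -- $(w/x_1)V$.
    have h2 : 0 ≤ (w • v - X *ᵥ u) ⬝ᵥ (w • v - X *ᵥ u) := dotProduct_self_nonneg' _
    simp only [sub_dotProduct, dotProduct_sub, smul_dotProduct, dotProduct_smul, smul_eq_mul,
      dotProduct_comm (X *ᵥ u) v] at h2
    have h3 : 2 * (v ⬝ᵥ X *ᵥ u) ≤ w * (v ⬝ᵥ v) + x₂ / w * (u ⬝ᵥ u) := by
      have h4 := hX₂ u
      rw [div_mul_eq_mul_div, ← sub_le_iff_le_add', le_div_iff₀ hw0]
      nlinarith
    have h5 : w / x₁ * (v ⬝ᵥ X *ᵥ v) ≤ w * (v ⬝ᵥ v) := by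
      rw [div_mul_eq_mul_div, div_le_iff₀ hx₁]
      nlinarith [hX₁ v]
    rw [mulVec_add, dotProduct_add]
    linarith
  refine ⟨w / x₁, x₂ / w, by positivity, by positivity, fun b r hb hr t ht => ?_⟩
  set α := w / x₁
  set c := x₂ / w
  set V : ℝ → ℝ := fun t => r t ⬝ᵥ X *ᵥ r t with hV
  have hr0 := hr.1 0 t ht Icc_subset_Ici_self
  have hVac : AbsolutelyContinuousOnInterval V 0 t := ac_dotProduct hr0 (ac_mulVec X hr0)
  have hVd : ∀ᵐ s ∂volume.restrict (Ici 0),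
      HasDerivAt V (2 * (r s ⬝ᵥ X *ᵥ (M *ᵥ r s + b s))) s := by
    filter_upwards [hr.2] with s hs
    convert hasDerivAt_dotProduct hs (hasDerivAt_const_mulVec X hs) using 1
    rw [dotProduct_mulVec_symm h.posDef (M *ᵥ r s + b s)]
    ring
  have hbi := hb.intervalIntegrable_dotProduct_self ht
  have hVc : ContinuousOn V (uIcc 0 t) := hVac.continuousOn
  have hEd : ∀ s, HasDerivAt (fun s => Real.exp (α * s)) (α * Real.exp (α * s)) s := fun s => by
    simpa [mul_comm] using ((hasDerivAt_id s).const_mul α).exp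
  constructor
  · have hEac : AbsolutelyContinuousOnInterval (fun s => Real.exp (α * s)) 0 t :=
      ContDiffOn.absolutelyContinuousOnInterval (by fun_prop)
    obtain ⟨i1, i2⟩ := integral_eq_sub_of_ac ht (hEac.mul hVac)
      (ψ := fun s => α * Real.exp (α * s) * V s +
        Real.exp (α * s) * (2 * (r s ⬝ᵥ X *ᵥ (M *ᵥ r s + b s)))) (by
        filter_upwards [hVd] with s hs
        exact (hEd s).mul hs)
    have i3 : ∫ s in (0 : ℝ)..t, (α * Real.exp (α * s) * V s +
        Real.exp (α * s) * (2 * (r s ⬝ᵥ X *ᵥ (M *ᵥ r s + b s)))) ≤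
        ∫ s in (0 : ℝ)..t, c * (Real.exp (α * s) * (b s ⬝ᵥ b s)) := by
      refine intervalIntegral.integral_mono_on ht i1
        ((hbi.continuousOn_mul (by fun_prop)).const_mul c) fun s _ => ?_
      have := mul_le_mul_of_nonneg_left (young (r s) (b s)) (Real.exp_pos (α * s)).le
      simp only [hV]
      linarith
    rw [i2, intervalIntegral.integral_const_mul] at i3
    simp only [Pi.mul_apply, mul_zero, Real.exp_zero, one_mul] at i3
    linarith
  · obtain ⟨i1, i2⟩ := integral_eq_sub_of_ac ht hVac hVd
    have i3 : ∫ s in (0 : ℝ)..t, 2 * (r s ⬝ᵥ X *ᵥ (M *ᵥ r s + b s)) ≤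
        ∫ s in (0 : ℝ)..t, (-α * V s + c * (b s ⬝ᵥ b s)) :=
      intervalIntegral.integral_mono_on ht i1
        ((hVc.intervalIntegrable.const_mul _).add (hbi.const_mul c)) fun s _ =>
          young (r s) (b s)
    rw [i2, intervalIntegral.integral_add (hVc.intervalIntegrable.const_mul _) (hbi.const_mul c),
      intervalIntegral.integral_const_mul, intervalIntegral.integral_const_mul] at i3
    have : 0 ≤ V t := by simpa using h.posDef.posSemidef.dotProduct_mulVec_nonneg (r t)
    linarith

theorem IsLyapunov.exists_dotProduct_sq_le {d : ℕ} {X M : Matrix (Fin d) (Fin d) ℝ}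
    (h : IsLyapunov X M) (w : Fin d → ℝ) :
    ∃ κ : ℝ, 0 ≤ κ ∧ ∀ v, (w ⬝ᵥ v) ^ 2 ≤ κ * (v ⬝ᵥ X *ᵥ v) := by
  obtain ⟨x, hx, hx'⟩ := exists_le_dotProduct_mulVec X
  have hx0 : 0 < x := hx' fun v hv => PosDef.dotProduct_pos h.posDef hv
  have hw := dotProduct_self_nonneg' w
  refine ⟨(w ⬝ᵥ w) / x, by positivity, fun v => (dotProduct_sq_le w v).trans ?_⟩
  rw [div_mul_eq_mul_div, le_div_iff₀ hx0]
  nlinarith [hx v]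

theorem IsLyapunov.tendsto_dotProduct {d : ℕ} {X M : Matrix (Fin d) (Fin d) ℝ}
    (h : IsLyapunov X M) (w : Fin d → ℝ) {b r : ℝ → Fin d → ℝ} (hb : L2Loc (Ici 0) b)
    (hr : SolvesODE (Ici 0) M b r) (hb0 : ∀ᵐ t ∂volume.restrict (Ici 0), b t = 0) :
    Tendsto (fun t => w ⬝ᵥ r t) atTop (𝓝 0) := by
  obtain ⟨α, c, hα, -, H⟩ := h.exists_decay
  obtain ⟨κ, hκ, hκ'⟩ := h.exists_dotProduct_sq_le w
  have hz : ∀ t, 0 ≤ t → ∫ s in (0 : ℝ)..t, Real.exp (α * s) * (b s ⬝ᵥ b s) = 0 := by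
    intro t ht
    refine intervalIntegral.integral_zero_ae ?_
    rw [ae_restrict_iff' measurableSet_Ici] at hb0
    filter_upwards [hb0] with s hs hst
    rw [uIoc_of_le ht] at hst
    rw [hs hst.1.le]
    simp
  have key : ∀ t, 0 ≤ t → (w ⬝ᵥ r t) ^ 2 ≤ κ * (r 0 ⬝ᵥ X *ᵥ r 0) * Real.exp (-(α * t)) := by
    intro t ht
    have h1 := (H b r hb hr t ht).1
    rw [hz t ht, mul_zero, add_zero, mul_comm, ← le_div_iff₀ (Real.exp_pos _), div_eq_mul_inv,
      ← Real.exp_neg] at h1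
    calc (w ⬝ᵥ r t) ^ 2 ≤ κ * (r t ⬝ᵥ X *ᵥ r t) := hκ' _
      _ ≤ κ * (r 0 ⬝ᵥ X *ᵥ r 0 * Real.exp (-(α * t))) := mul_le_mul_of_nonneg_left h1 hκ
      _ = _ := by ring
  have hlim : Tendsto (fun t => κ * (r 0 ⬝ᵥ X *ᵥ r 0) * Real.exp (-(α * t))) atTop (𝓝 0) := by
    have := (Real.tendsto_exp_neg_atTop_nhds_zero.comp
      (tendsto_id.const_mul_atTop hα)).const_mul (κ * (r 0 ⬝ᵥ X *ᵥ r 0))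
    simpa using this
  have h2 : Tendsto (fun t => (w ⬝ᵥ r t) ^ 2) atTop (𝓝 0) :=
    tendsto_of_tendsto_of_tendsto_of_le_of_le' tendsto_const_nhds hlim
      (Eventually.of_forall fun t => sq_nonneg _) ((eventually_ge_atTop 0).mono key)
  have h3 := h2.sqrt
  simp only [Real.sqrt_sq_eq_abs, Real.sqrt_zero] at h3
  exact (tendsto_zero_iff_abs_tendsto_zero _).2 h3

theorem IsLyapunov.exists_bound_dotProduct {d : ℕ} {X M : Matrix (Fin d) (Fin d) ℝ}
    (h : IsLyapunov X M) (w : Fin d → ℝ) {b r : ℝ → Fin d → ℝ} (hb : L2Loc (Ici 0) b)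
    (hr : SolvesODE (Ici 0) M b r) {β : ℝ}
    (hbβ : ∀ᵐ t ∂volume.restrict (Ici 0), b t ⬝ᵥ b t ≤ β) :
    ∃ C : ℝ, ∀ t, 0 ≤ t → (w ⬝ᵥ r t) ^ 2 ≤ C := by
  obtain ⟨α, c, hα, hc, H⟩ := h.exists_decay
  obtain ⟨κ, hκ, hκ'⟩ := h.exists_dotProduct_sq_le w
  set V₀ := r 0 ⬝ᵥ X *ᵥ r 0
  have hV₀ : 0 ≤ V₀ := by simpa using h.posDef.posSemidef.dotProduct_mulVec_nonneg (r 0)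
  -- The weighted forcing integral is at most $(|\beta|/\alpha)e^{\alpha t}$, so the weight cancels
  -- and the bound does not depend on $t$.
  refine ⟨κ * (V₀ + c * (|β| / α)), fun t ht => (hκ' _).trans (mul_le_mul_of_nonneg_left ?_ hκ)⟩
  have hi : ∫ s in (0 : ℝ)..t, Real.exp (α * s) * (b s ⬝ᵥ b s) ≤
      |β| / α * Real.exp (α * t) := by
    calc ∫ s in (0 : ℝ)..t, Real.exp (α * s) * (b s ⬝ᵥ b s)
        ≤ ∫ s in (0 : ℝ)..t, Real.exp (α * s) * |β| := by
          refine intervalIntegral.integral_mono_ae_restrict ht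
            ((hb.intervalIntegrable_dotProduct_self ht).continuousOn_mul (by fun_prop))
            (Continuous.intervalIntegrable (by fun_prop) _ _) ?_
          filter_upwards [ae_mono (Measure.restrict_mono Icc_subset_Ici_self le_rfl) hbβ] with s hs
          exact mul_le_mul_of_nonneg_left (hs.trans (le_abs_self β)) (Real.exp_pos _).le
      _ = |β| / α * (Real.exp (α * t) - 1) := by
          rw [intervalIntegral.integral_mul_const,
            intervalIntegral.integral_comp_mul_left _ hα.ne', integral_exp]
          simp
          ring
      _ ≤ _ := mul_le_mul_of_nonneg_left (by linarith) (by positivity)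
  have h1 := (H b r hb hr t ht).1
  have hE : 1 ≤ Real.exp (α * t) := Real.one_le_exp (by positivity)
  refine le_of_mul_le_mul_left (h1.trans ?_) (Real.exp_pos (α * t))
  have h2 := mul_le_mul_of_nonneg_left hi hc.le
  nlinarith

theorem IsLyapunov.memLp_dotProduct {d : ℕ} {X M : Matrix (Fin d) (Fin d) ℝ}
    (h : IsLyapunov X M) (w : Fin d → ℝ) {b r : ℝ → Fin d → ℝ} (hb : L2Loc (Ici 0) b)
    (hr : SolvesODE (Ici 0) M b r) (hb2 : MemLp b 2 (volume.restrict (Ici 0))) :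
    MemLp (fun t => w ⬝ᵥ r t) 2 (volume.restrict (Ici 0)) := by
  obtain ⟨α, c, hα, hc, H⟩ := h.exists_decay
  obtain ⟨κ, hκ, hκ'⟩ := h.exists_dotProduct_sq_le w
  have hrc := hr.1.continuousOn
  have hcont : ContinuousOn (fun t => w ⬝ᵥ r t) (Ici 0) := by
    simp only [dotProduct]
    exact continuousOn_finsetSum _ fun i _ =>
      continuousOn_const.mul ((continuous_apply i).comp_continuousOn hrc)
  have hVc : ContinuousOn (fun t => r t ⬝ᵥ X *ᵥ r t) (Ici 0) :=
    (show Continuous fun v : Fin d → ℝ => v ⬝ᵥ X *ᵥ v by fun_prop).comp_continuousOn hrc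
  have hVi : ∀ t, 0 ≤ t → IntervalIntegrable (fun t => r t ⬝ᵥ X *ᵥ r t) volume 0 t :=
    fun t ht => (hVc.mono (by rw [uIcc_of_le ht]; exact Icc_subset_Ici_self)).intervalIntegrable
  have hei : ∀ t, 0 ≤ t → IntervalIntegrable (fun t => (w ⬝ᵥ r t) ^ 2) volume 0 t :=
    fun t ht => ((hcont.pow 2).mono
      (by rw [uIcc_of_le ht]; exact Icc_subset_Ici_self)).intervalIntegrable
  rw [memLp_two_iff_integrable_sq (hcont.aestronglyMeasurable measurableSet_Ici)]
  change IntegrableOn _ _ _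
  rw [integrableOn_Ici_iff_integrableOn_Ioi]
  have hbi := integrable_dotProduct_self hb2
  -- The truncations $[0,\max(t,0)]$ avoid a separate treatment of negative endpoints; their
  -- integrals are bounded uniformly by the second decay estimate.
  refine integrableOn_Ioi_of_intervalIntegral_norm_bounded
    (κ * ((r 0 ⬝ᵥ X *ᵥ r 0 + c * ∫ s in Ici 0, b s ⬝ᵥ b s) / α)) 0 (l := atTop)
    (b := fun t : ℝ => max t 0) (fun t => ?_) (tendsto_atTop_mono (fun t => le_max_left t 0)
      tendsto_id) (Eventually.of_forall fun t => ?_)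
  · exact (intervalIntegrable_iff_integrableOn_Ioc_of_le (le_max_right _ _)).1
      (hei _ (le_max_right _ _))
  · have ht : 0 ≤ max t 0 := le_max_right _ _
    generalize max t 0 = T at ht
    have h1 := (H b r hb hr T ht).2
    have h2 : ∫ s in (0 : ℝ)..T, b s ⬝ᵥ b s ≤ ∫ s in Ici 0, b s ⬝ᵥ b s := by
      rw [intervalIntegral.integral_of_le ht]
      exact setIntegral_mono_set hbi (ae_of_all _ fun s => dotProduct_self_nonneg' (b s))
        (Eventually.of_forall fun s hs => (le_of_lt hs.1 : (0 : ℝ) ≤ s))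
    have h3 : ∫ s in (0 : ℝ)..T, (w ⬝ᵥ r s) ^ 2 ≤
        ∫ s in (0 : ℝ)..T, κ * (r s ⬝ᵥ X *ᵥ r s) :=
      intervalIntegral.integral_mono_on ht (hei T ht) ((hVi T ht).const_mul κ) fun s _ => hκ' _
    rw [intervalIntegral.integral_const_mul] at h3
    simp only [Real.norm_of_nonneg (sq_nonneg _)]
    refine h3.trans (mul_le_mul_of_nonneg_left ?_ hκ)
    rw [le_div_iff₀ hα]
    have := mul_le_mul_of_nonneg_left h2 hc.le
    linarith

section

/-! ### The stabilizability subspace -/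

variable {m n p N k l r : ℕ}

theorem LTI.isTrajectory_variationOfConstants (S : LTI N k m p) {g : ℝ → Fin k → ℝ}
    (hg : L2Loc (Ici 0) g) (v₀ : Fin N → ℝ) :
    S.IsTrajectory (Ici 0) (variationOfConstants S.A (fun t => S.B *ᵥ g t) v₀) g :=
  ⟨hg, solvesODE_variationOfConstants S.A
    (fun _ ht => (hg.mulVec S.B).intervalIntegrable ht) v₀⟩

/-- Every functional vanishing on the stabilizability subspace vanishes on the range of `B`. -/
theorem LTI.vecMul_B_eq_zero (S : LTI N k m p) {ξ : Fin N → ℝ}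
    (hξ : ∀ v ∈ S.stabilizabilitySubspace, ξ ⬝ᵥ v = 0) : ξ ᵥ* S.B = 0 := by
  set Φ : ℝ → Matrix (Fin N) (Fin k) ℝ := fun s => NormedSpace.exp (-s • S.A) * S.B with hΦ
  have hΦc : Continuous Φ :=
    ((continuous_matrix_exp S.A).comp continuous_neg).matrix_mul continuous_const
  set u : ℝ → Fin k → ℝ := fun s => ξ ᵥ* Φ s with hu
  have huc : Continuous u := continuous_const.matrix_vecMul hΦc
  have hΦu : Continuous fun s => Φ s *ᵥ u s := hΦc.matrix_mulVec huc
  -- With $v_0=\int_0^1\Phi\Phi^\top\xi$, a controllability Gramian applied to $\xi$, this input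
  -- brings the state from $v_0$ to zero at time $1$ and then stops, so it stays there.
  set g : ℝ → Fin k → ℝ := (Iic 1).indicator fun s => -u s with hg
  have hgl : L2Loc (Ici 0) g := fun a b hab =>
    (l2Loc_of_continuous huc.neg (Ici 0) a b hab).indicator measurableSet_Iic
  set v₀ := ∫ s in (0 : ℝ)..1, Φ s *ᵥ u s
  have hmem : v₀ ∈ S.stabilizabilitySubspace := by
    refine ⟨_, g, S.isTrajectory_variationOfConstants hgl v₀, variationOfConstants_zero _ _ _, ?_⟩
    refine tendsto_const_nhds.congr' ?_
    filter_upwards [eventually_ge_atTop 1] with t ht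
    have hi := fun t ht => intervalIntegrable_exp_mulVec S.A
      (fun _ ht => (hgl.mulVec S.B).intervalIntegrable ht) (t := t) ht
    have h1 : ∫ s in (0 : ℝ)..1, NormedSpace.exp (-s • S.A) *ᵥ (S.B *ᵥ g s) = -v₀ := by
      rw [← intervalIntegral.integral_neg]
      refine intervalIntegral.integral_congr fun s hs => ?_
      rw [uIcc_of_le zero_le_one] at hs
      simp [hg, hΦ, indicator_of_mem (show s ∈ Iic (1 : ℝ) from hs.2), mulVec_neg]
    have h2 : ∫ s in (1 : ℝ)..t, NormedSpace.exp (-s • S.A) *ᵥ (S.B *ᵥ g s) = 0 := by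
      refine intervalIntegral.integral_zero_ae (ae_of_all _ fun s hs => ?_)
      rw [uIoc_of_le ht] at hs
      simp [hg, indicator_of_notMem (show s ∉ Iic (1 : ℝ) from not_le.2 hs.1)]
    have h3 := intervalIntegral.integral_interval_sub_left (hi t (by linarith))
      (hi 1 zero_le_one)
    rw [h2, h1, sub_eq_zero] at h3
    rw [variationOfConstants, h3, add_neg_cancel, mulVec_zero]
  -- Pairing $v_0$ with $\xi$ gives the energy of $u$; as $u$ is continuous, it vanishes at $0$,
  -- where it equals $\xi^\top B$.
  have hint : ∫ s in (0 : ℝ)..1, u s ⬝ᵥ u s = 0 := by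
    have h := hξ v₀ hmem
    rw [dotProduct_intervalIntegral _ (hΦu.intervalIntegrable _ _)] at h
    simpa only [dotProduct_mulVec] using h
  by_contra hne
  have h0 : u 0 = ξ ᵥ* S.B := by simp [hu, hΦ]
  have hpos : 0 < ∫ s in (0 : ℝ)..1, u s ⬝ᵥ u s :=
    intervalIntegral.integral_pos zero_lt_one (huc.dotProduct huc).continuousOn
      (fun s _ => dotProduct_self_nonneg' (u s))
      ⟨0, ⟨le_rfl, zero_le_one⟩, dotProduct_self_pos (by rwa [h0])⟩
  exact hpos.ne' hint

theorem LTI.IsTrajectory.shift {S : LTI N k m p} {v : ℝ → Fin N → ℝ} {g : ℝ → Fin k → ℝ}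
    (h : S.IsTrajectory (Ici 0) v g) {τ : ℝ} (hτ : 0 ≤ τ) :
    S.IsTrajectory (Ici 0) (fun t => v (t + τ)) (fun t => g (t + τ)) := by
  refine ⟨fun a b hab => ?_, fun a b hab hI => ?_, ?_⟩
  · rcases lt_or_ge b a with hlt | hle
    · simp [Icc_eq_empty hlt.not_ge]
    have ha : 0 ≤ a := hab ⟨le_rfl, hle⟩
    have h1 := h.1 (a + τ) (b + τ) fun s hs => (add_nonneg ha hτ).trans hs.1
    have h2 := (measurePreserving_add_right (volume : Measure ℝ) τ).restrict_preimage
      (measurableSet_Icc (a := a + τ) (b := b + τ))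
    have h3 : (fun x => x + τ) ⁻¹' Icc (a + τ) (b + τ) = Icc a b := by simp
    rw [h3] at h2
    exact h1.comp_measurePreserving h2
  · have ha : 0 ≤ a := hI ⟨le_rfl, hab⟩
    exact ac_comp_add (h.2.1 (a + τ) (b + τ) (by linarith)
      fun s hs => (add_nonneg ha hτ).trans hs.1)
  · have h1 := h.2.2
    rw [ae_restrict_iff' measurableSet_Ici] at h1 ⊢
    filter_upwards [(measurePreserving_add_right (volume : Measure ℝ)
      τ).quasiMeasurePreserving.ae h1] with t ht h0
    exact (ht (add_nonneg h0 hτ)).comp_add_const t τ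

/-- Time invariance: restarting at $\tau$ a trajectory that tends to zero gives another one. -/
theorem LTI.mem_stabilizabilitySubspace_of_trajectory {S : LTI N k m p} {v : ℝ → Fin N → ℝ}
    {g : ℝ → Fin k → ℝ} (h : S.IsTrajectory (Ici 0) v g) (hv : Tendsto v atTop (𝓝 0)) {τ : ℝ}
    (hτ : 0 ≤ τ) : v τ ∈ S.stabilizabilitySubspace :=
  ⟨_, _, h.shift hτ, by simp, hv.comp (tendsto_atTop_add_const_right _ τ tendsto_id)⟩

theorem eqOn_Ici_of_ae_eq {d : ℕ} {z w : ℝ → Fin d → ℝ} (hz : ContinuousOn z (Ici 0))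
    (hw : ContinuousOn w (Ici 0)) (h : ∀ᵐ t ∂volume.restrict (Ici 0), z t = w t) :
    EqOn z w (Ici 0) := by
  have h1 : EqOn z w (Ioi 0) :=
    Measure.eqOn_open_of_ae_eq (μ := volume)
      (ae_mono (Measure.restrict_mono Ioi_subset_Ici_self le_rfl) h) isOpen_Ioi
      (hz.mono Ioi_subset_Ici_self) (hw.mono Ioi_subset_Ici_self)
  exact h1.of_subset_closure hz hw Ioi_subset_Ici_self (by rw [closure_Ioi])

/-- The annihilator of the stabilizability subspace is invariant under `Aᵀ`. -/
theorem LTI.vecMul_A_dotProduct_eq_zero (S : LTI N k m p) {ξ : Fin N → ℝ}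
    (hξ : ∀ v ∈ S.stabilizabilitySubspace, ξ ⬝ᵥ v = 0) {v₀ : Fin N → ℝ}
    (hv₀ : v₀ ∈ S.stabilizabilitySubspace) : (ξ ᵥ* S.A) ⬝ᵥ v₀ = 0 := by
  obtain ⟨v, g, hvg, rfl, hlim⟩ := hv₀
  have hz : ∀ t, 0 ≤ t → ξ ⬝ᵥ v t = 0 := fun t ht =>
    hξ _ (mem_stabilizabilitySubspace_of_trajectory hvg hlim ht)
  have hB := S.vecMul_B_eq_zero hξ
  -- Along the trajectory $\xi\cdot v$ is constantly zero, so its derivative $\xi^\top A v$ vanishes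
  -- too, the input term being killed by $\xi^\top B=0$; continuity carries this to $t=0$. The
  -- scalar is packed as a `Fin 1` vector to fit `eqOn_Ici_of_ae_eq`.
  have hae : ∀ᵐ t ∂volume.restrict (Ici 0),
      (fun _ : Fin 1 => (ξ ᵥ* S.A) ⬝ᵥ v t) = fun _ => 0 := by
    rw [ae_restrict_iff' measurableSet_Ici]
    have h2 := hvg.2.2
    rw [ae_restrict_iff' measurableSet_Ici] at h2
    -- Time $0$ is removed because the two-sided derivative there depends on values outside
    -- $[0,\infty)$.
    filter_upwards [h2, Measure.ae_ne volume (0 : ℝ)] with t ht h0 ht0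
    have hpos : 0 < t := lt_of_le_of_ne ht0 h0.symm
    have hd := hasDerivAt_dotProduct (hasDerivAt_const t ξ) (ht ht0)
    have hd0 : HasDerivAt (fun s => ξ ⬝ᵥ v s) 0 t :=
      (hasDerivAt_const t (0 : ℝ)).congr_of_eventuallyEq
        ((lt_mem_nhds hpos).mono fun s hs => hz s hs.le)
    have := hd.unique hd0
    rw [zero_dotProduct, zero_add, dotProduct_add, dotProduct_mulVec, dotProduct_mulVec, hB,
      zero_dotProduct, add_zero] at this
    simp [this]
  have hc : ContinuousOn (fun t => fun _ : Fin 1 => (ξ ᵥ* S.A) ⬝ᵥ v t) (Ici 0) :=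
    (show Continuous fun w : Fin N → ℝ => fun _ : Fin 1 => (ξ ᵥ* S.A) ⬝ᵥ w by
      fun_prop).comp_continuousOn hvg.2.1.continuousOn
  exact congrFun (eqOn_Ici_of_ae_eq hc continuousOn_const hae (mem_Ici.2 le_rfl)) 0

/-! ### Restriction to the stabilizability subspace -/

section Restrict

variable {S : LTI N k m p} {T : Matrix (Fin l ⊕ Fin r) (Fin N) ℝ}
  {T' : Matrix (Fin N) (Fin l ⊕ Fin r) ℝ}

theorem LTI.IsAdaptedBasis.toRows₁_mul_toCols₁ (h : S.IsAdaptedBasis T T') :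
    T.toRows₁ * T'.toCols₁ = 1 := by
  ext i j
  have := congrFun (congrFun h.mul_inv (Sum.inl i)) (Sum.inl j)
  simpa [Matrix.mul_apply, Matrix.one_apply] using this

/-- In $X=T'(TX)$ only the first column block of $T'$ survives. Applied to $B$, to $A T'_1$ and to
single vectors, it expresses that their columns lie in the stabilizability subspace. -/
theorem LTI.IsAdaptedBasis.eq_toCols₁_mul (h : S.IsAdaptedBasis T T') {κ : Type*}
    (X : Matrix (Fin N) κ ℝ) (hX : (T * X).toRows₂ = 0) : X = T'.toCols₁ * (T * X).toRows₁ := by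
  conv_lhs => rw [← Matrix.one_mul X, ← h.inv_mul, Matrix.mul_assoc,
    ← fromCols_toCols T', ← fromRows_toRows (T * X), fromCols_mul_fromRows, hX,
    Matrix.mul_zero, add_zero]

/-- The last rows of $T$ are the annihilating functionals $\xi$ for the two results on the
stabilizability subspace. -/
theorem LTI.IsAdaptedBasis.dotProduct_eq_zero (h : S.IsAdaptedBasis T T') (j : Fin r) :
    ∀ v ∈ S.stabilizabilitySubspace, T (Sum.inr j) ⬝ᵥ v = 0 :=
  fun v hv => (h.mem_iff v).1 hv j

theorem LTI.IsAdaptedBasis.toCols₁_mulVec_toRows₁_mulVec (h : S.IsAdaptedBasis T T')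
    {v : Fin N → ℝ} (hv : v ∈ S.stabilizabilitySubspace) :
    T'.toCols₁ *ᵥ (T.toRows₁ *ᵥ v) = v := by
  have := h.eq_toCols₁_mul (replicateCol (Fin 1) v) (by
    ext j i
    exact (h.mem_iff v).1 hv j)
  funext i
  have := congrFun (congrFun this i) 0
  simpa [Matrix.mul_apply, mulVec, dotProduct] using this.symm

theorem LTI.IsAdaptedBasis.B_eq (h : S.IsAdaptedBasis T T') :
    S.B = T'.toCols₁ * (S.restrict T T').B :=
  h.eq_toCols₁_mul S.B (by
    ext j i
    exact congrFun (S.vecMul_B_eq_zero (h.dotProduct_eq_zero j)) i)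

theorem LTI.IsAdaptedBasis.toCols₁_mem (h : S.IsAdaptedBasis T T') (i : Fin l) :
    (fun a => T'.toCols₁ a i) ∈ S.stabilizabilitySubspace := by
  rw [h.mem_iff]
  intro j
  have := congrFun (congrFun h.mul_inv (Sum.inr j)) (Sum.inl i)
  simpa [Matrix.mul_apply, mulVec, dotProduct, Matrix.one_apply] using this

theorem LTI.IsAdaptedBasis.A_mul (h : S.IsAdaptedBasis T T') :
    S.A * T'.toCols₁ = T'.toCols₁ * (S.restrict T T').A := by
  have h1 := h.eq_toCols₁_mul (S.A * T'.toCols₁) (by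
    ext j i
    have := S.vecMul_A_dotProduct_eq_zero (h.dotProduct_eq_zero j) (h.toCols₁_mem i)
    rw [← dotProduct_mulVec] at this
    exact this)
  rw [h1, ← Matrix.mul_assoc T]
  rfl

theorem LTI.restrict_C : (S.restrict T T').C = S.C * T'.toCols₁ := by
  ext i j
  simp [LTI.restrict, Matrix.mul_apply]

end Restrict

end

section

variable {m n p N k l : ℕ}

theorem mulVec_injective_of_rank {ι : Type*} [Fintype ι] {G : Matrix ι (Fin N) ℝ}
    (h : G.rank = N) : Function.Injective G.mulVec := by
  have h1 := LinearMap.finrank_range_add_finrank_ker G.mulVecLin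
  rw [← Matrix.rank, h, Module.finrank_fin_fun, Nat.add_eq_left, Submodule.finrank_eq_zero] at h1
  exact LinearMap.ker_eq_bot.1 h1

/-! ### The Lyapunov function of the closed loop -/

theorem closedLoop_lyapunov_eq {Sg : LTI l k m p} {Q : Matrix (Fin m) (Fin m) ℝ}
    {R : Matrix (Fin p) (Fin p) ℝ} (hQ : Q.PosDef) (hR : R.PosDef)
    (hD : Sg.D = 0 ∨ Sg.D.rank = k) {P : Matrix (Fin l) (Fin l) ℝ} (hP : P.PosDef)
    (hARE : SolvesARE Sg Q R P) :
    P * closedLoopA Sg (gain Sg Q R P) + (closedLoopA Sg (gain Sg Q R P))ᵀ * P =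
      -((closedLoopC Sg (gain Sg Q R P))ᵀ * weight Q R * closedLoopC Sg (gain Sg Q R P)) := by
  have hPs : Pᵀ = P := by simpa using hP.isHermitian.eq
  have hW := weight_posDef hQ hR
  have hWs : (weight Q R)ᵀ = weight Q R := by simpa using hW.isHermitian.eq
  -- For $D\ne0$ full column rank makes $D^\top SD$ positive definite, so the matrix inverse in the
  -- gain is a genuine one. For $D=0$ the gain is zero and the Riccati equation already is the
  -- Lyapunov equation.
  have hK : Sg.Dᵀ * weight Q R * Sg.D * gain Sg Q R P = if Sg.D = 0 then 0 else
      Sg.Bᵀ * P + Sg.Dᵀ * weight Q R * Sg.C := by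
    rw [gain]
    split_ifs with h0
    · rw [Matrix.mul_zero]
    · have hinj := mulVec_injective_of_rank (hD.resolve_left h0)
      have hDD : (Sg.Dᵀ * weight Q R * Sg.D).PosDef := by
        simpa using hW.conjTranspose_mul_mul_same hinj
      rw [← Matrix.mul_assoc, Matrix.mul_nonsing_inv _ ((Matrix.isUnit_iff_isUnit_det _).1
        hDD.isUnit), Matrix.one_mul]
  have hare : P * Sg.A + Sg.Aᵀ * P = (gain Sg Q R P)ᵀ *
      (Sg.Dᵀ * weight Q R * Sg.D * gain Sg Q R P) - Sg.Cᵀ * weight Q R * Sg.C := by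
    have := hARE
    rw [SolvesARE] at this
    rw [eq_sub_iff_add_eq, ← sub_eq_zero, ← Matrix.mul_assoc, eq_comm, this]
    abel
  by_cases h0 : Sg.D = 0
  · have hg : gain Sg Q R P = 0 := if_pos h0
    rw [hg] at hare ⊢
    simpa [closedLoopA, closedLoopC] using hare
  · rw [if_neg h0] at hK
    set K := gain Sg Q R P
    set W := weight Q R
    have hKt : Kᵀ * (Sg.Dᵀ * W * Sg.D) = P * Sg.B + Sg.Cᵀ * W * Sg.D := by
      have := congrArg transpose hK
      simpa [transpose_mul, hWs, hPs, Matrix.mul_assoc] using this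
    have e1 : P * closedLoopA Sg K + (closedLoopA Sg K)ᵀ * P =
        P * Sg.A + Sg.Aᵀ * P - P * Sg.B * K - Kᵀ * (Sg.Bᵀ * P) := by
      simp only [closedLoopA, transpose_sub, transpose_mul, Matrix.mul_sub, Matrix.sub_mul,
        Matrix.mul_assoc]
      abel
    have e2 : (closedLoopC Sg K)ᵀ * W * closedLoopC Sg K =
        Sg.Cᵀ * W * Sg.C - Sg.Cᵀ * W * Sg.D * K - Kᵀ * (Sg.Dᵀ * W * Sg.C) +
          Kᵀ * (Sg.Dᵀ * W * Sg.D * K) := by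
      simp only [closedLoopC, transpose_sub, transpose_mul, Matrix.mul_sub, Matrix.sub_mul,
        Matrix.mul_assoc]
      abel
    have e3 : Kᵀ * (Sg.Dᵀ * W * Sg.D * K) = P * Sg.B * K + Sg.Cᵀ * W * Sg.D * K := by
      rw [← Matrix.mul_assoc, hKt, Matrix.add_mul]
    have e4 : Kᵀ * (Sg.Bᵀ * P) + Kᵀ * (Sg.Dᵀ * W * Sg.C) = Kᵀ * (Sg.Dᵀ * W * Sg.D * K) := by
      rw [hK, Matrix.mul_add]
    rw [e1, e2, hare, eq_sub_of_add_eq e4, e3]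
    abel

/-- Passing to the transpose replaces $P$ by its inverse: with $v=Ps$, $v\cdot P^{-1}M^\top v=s\cdot
M^\top Ps=-\tfrac12\,Cs\cdot WCs$. -/
theorem isLyapunov_of_lyapunov_eq {ι : Type*} [Fintype ι] {P M : Matrix (Fin l) (Fin l) ℝ}
    {W : Matrix ι ι ℝ} {C : Matrix ι (Fin l) ℝ} (hP : P.PosDef) (hW : W.PosDef)
    (hC : Function.Injective C.mulVec) (h : P * M + Mᵀ * P = -(Cᵀ * W * C)) :
    IsLyapunov P⁻¹ Mᵀ := by
  refine ⟨hP.inv, fun v hv => ?_⟩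
  have hdet : IsUnit P.det := (Matrix.isUnit_iff_isUnit_det _).1 hP.isUnit
  obtain ⟨s, rfl⟩ : ∃ s, v = P *ᵥ s := ⟨P⁻¹ *ᵥ v, by
    rw [mulVec_mulVec, Matrix.mul_nonsing_inv _ hdet, one_mulVec]⟩
  have hs : s ≠ 0 := by
    rintro rfl
    simp at hv
  have hCs : C *ᵥ s ≠ 0 := fun h0 => hs (hC (by rw [h0, mulVec_zero]))
  have hpos := PosDef.dotProduct_pos hW hCs
  rw [dotProduct_mulVec_symm hP.inv, mulVec_mulVec _ P⁻¹, Matrix.nonsing_inv_mul _ hdet,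
    one_mulVec, dotProduct_comm]
  have e1 : s ⬝ᵥ (P * M + Mᵀ * P) *ᵥ s = 2 * (s ⬝ᵥ Mᵀ *ᵥ (P *ᵥ s)) := by
    rw [add_mulVec, dotProduct_add, ← mulVec_mulVec, ← mulVec_mulVec,
      dotProduct_mulVec_symm hP s (M *ᵥ s), dotProduct_mulVec_comm Mᵀ, transpose_transpose]
    ring
  have e2 : s ⬝ᵥ (-(Cᵀ * W * C)) *ᵥ s = -((C *ᵥ s) ⬝ᵥ W *ᵥ (C *ᵥ s)) := by
    rw [neg_mulVec, dotProduct_neg, Matrix.mul_assoc, ← mulVec_mulVec, ← mulVec_mulVec,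
      dotProduct_mulVec_comm Cᵀ, transpose_transpose]
  rw [h, e2] at e1
  linarith

/-! ### The dual equation in closed loop -/

/-- `Sg` is the restriction of `S` to an invariant subspace with basis matrix `J`. -/
structure LTI.IsRestriction (S : LTI N k m p) (Sg : LTI l k m p)
    (J : Matrix (Fin N) (Fin l) ℝ) : Prop where
  A_mul : S.A * J = J * Sg.A
  B_eq : S.B = J * Sg.B
  C_eq : Sg.C = S.C * J
  D_eq : Sg.D = S.D

theorem LTI.IsAdaptedBasis.isRestriction {r : ℕ} {S : LTI N k m p}
    {T : Matrix (Fin l ⊕ Fin r) (Fin N) ℝ} {T' : Matrix (Fin N) (Fin l ⊕ Fin r) ℝ}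
    (h : S.IsAdaptedBasis T T') : S.IsRestriction (S.restrict T T') T'.toCols₁ :=
  ⟨h.A_mul, h.B_eq, LTI.restrict_C, rfl⟩

variable {F A : Matrix (Fin m) (Fin n) ℝ} {H : Matrix (Fin p) (Fin n) ℝ} {S : LTI N k m p}
  {Sg : LTI l k m p} {J : Matrix (Fin N) (Fin l) ℝ}

theorem toRows₁_mulVec {ι : Type*} [Fintype ι] (M : Matrix (Fin m ⊕ Fin p) ι ℝ) (v : ι → ℝ) :
    M.toRows₁ *ᵥ v = fun i => (M *ᵥ v) (Sum.inl i) := rfl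

/-- Feedback is invisible in $F^\top q$ because $F^\top D_s=0$. -/
theorem LTI.IsRestriction.mul_closedLoopC (h : S.IsRestriction Sg J) (hS : IsAssociated F A H S)
    (K : Matrix (Fin k) (Fin l) ℝ) :
    Fᵀ * (closedLoopC Sg K).toRows₁ = Fᵀ * S.C.toRows₁ * J := by
  have e1 : (closedLoopC Sg K).toRows₁ = S.C.toRows₁ * J - S.D.toRows₁ * K := by
    rw [closedLoopC, h.C_eq, h.D_eq]
    rfl
  rw [e1, Matrix.mul_sub, ← Matrix.mul_assoc, ← Matrix.mul_assoc, hS.direct_eq, Matrix.zero_mul,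
    sub_zero]

theorem LTI.IsRestriction.closedLoopC_injective (h : S.IsRestriction Sg J)
    (hS : IsAssociated F A H S) (hJ : Function.Injective J.mulVec) (K : Matrix (Fin k) (Fin l) ℝ) :
    Function.Injective (closedLoopC Sg K).mulVec := by
  intro v w hvw
  have h1 : (closedLoopC Sg K).toRows₁ *ᵥ v = (closedLoopC Sg K).toRows₁ *ᵥ w := by
    rw [toRows₁_mulVec, toRows₁_mulVec]
    exact congrArg (fun z i => z (Sum.inl i)) hvw
  have h2 := congrArg (fun z => Fᵀ *ᵥ z) h1
  simp only [mulVec_mulVec] at h2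
  rw [h.mul_closedLoopC hS, ← mulVec_mulVec v, ← mulVec_mulVec w] at h2
  exact hJ (mulVec_injective_of_rank hS.state_rank h2)

/-- The closed loop trajectories solve the dual equation. -/
theorem LTI.IsRestriction.closedLoop_dual_eq (h : S.IsRestriction Sg J)
    (hS : IsAssociated F A H S) (K : Matrix (Fin k) (Fin l) ℝ) :
    Fᵀ * (closedLoopC Sg K).toRows₁ * closedLoopA Sg K =
      Aᵀ * (closedLoopC Sg K).toRows₁ - Hᵀ * (closedLoopC Sg K).toRows₂ := by
  refine Matrix.ext_of_mulVec_single fun i => ?_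
  set M := closedLoopA Sg K with hM
  set C := closedLoopC Sg K with hC
  set w₀ : Fin l → ℝ := Pi.single i 1
  set w : ℝ → Fin l → ℝ := fun t => NormedSpace.exp (t • M) *ᵥ w₀ with hw
  have hw0 : w 0 = w₀ := by simp [hw]
  have hwd : ∀ t, HasDerivAt w (M *ᵥ w t) t := hasDerivAt_exp_mulVec M w₀
  have hwc : ContDiff ℝ 1 w := contDiff_exp_mulVec M w₀
  have hwcont : Continuous w := hwc.continuous
  clear_value w
  -- The lifted state $Jw$ with input $-Kw$ is a trajectory of the full system, because $A_aJ=JA_g$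
  -- and $B_a=JB_g$.
  have htraj : S.IsTrajectory (Ici 0) (fun t => J *ᵥ w t) (fun t => -(K *ᵥ w t)) := by
    refine ⟨l2Loc_of_continuous (by fun_prop) _, fun a b hab hI =>
      ac_mulVec J (acOn_of_contDiff hwc _ a b hab hI), ae_of_all _ fun t => ?_⟩
    convert hasDerivAt_const_mulVec J (hwd t) using 1
    change S.A *ᵥ (J *ᵥ w t) + S.B *ᵥ (-(K *ᵥ w t)) = _
    rw [hM, closedLoopA, mulVec_neg, h.B_eq, mulVec_mulVec, mulVec_mulVec, mulVec_mulVec, h.A_mul,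
      Matrix.mul_sub, sub_mulVec, Matrix.mul_assoc, sub_eq_add_neg]
  have hout : ∀ t, Sum.elim (C.toRows₁ *ᵥ w t) (C.toRows₂ *ᵥ w t) =
      S.C *ᵥ (J *ᵥ w t) + S.D *ᵥ (-(K *ᵥ w t)) := by
    intro t
    have e : S.C *ᵥ (J *ᵥ w t) + S.D *ᵥ (-(K *ᵥ w t)) = C *ᵥ w t := by
      rw [hC, closedLoopC, h.C_eq, h.D_eq, sub_mulVec, mulVec_neg, mulVec_mulVec, mulVec_mulVec,
        sub_eq_add_neg]
    rw [e]
    funext j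
    rcases j with j | j <;> rfl
  obtain ⟨z, -, -, hz⟩ := (hS.behavior (Ici 0) (Or.inl rfl) (fun t => C.toRows₁ *ᵥ w t)
    (fun t => C.toRows₂ *ᵥ w t)).2 ⟨_, _, htraj, ae_of_all _ hout⟩
  have hzc := hz.ac.continuousOn
  have heq : EqOn (fun t => Fᵀ *ᵥ (C.toRows₁ *ᵥ w t)) z (Ici 0) :=
    eqOn_Ici_of_ae_eq (by fun_prop) hzc hz.ae_eq
  have hd1 : HasDerivWithinAt (fun t => Fᵀ *ᵥ (C.toRows₁ *ᵥ w t))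
      (Fᵀ *ᵥ (C.toRows₁ *ᵥ (M *ᵥ w 0))) (Ici 0) 0 :=
    (hasDerivAt_const_mulVec _ (hasDerivAt_const_mulVec _ (hwd 0))).hasDerivWithinAt
  set ψ : ℝ → Fin n → ℝ := fun s => Aᵀ *ᵥ (C.toRows₁ *ᵥ w s) + -(Hᵀ *ᵥ (C.toRows₂ *ᵥ w s))
    with hψ
  have hψc : Continuous ψ := by fun_prop
  have hd2 : HasDerivWithinAt (fun t => Fᵀ *ᵥ (C.toRows₁ *ᵥ w t)) (ψ 0) (Ici 0) 0 := by
    have := ((hψc.integral_hasStrictDerivAt 0 0).hasDerivAt.const_add (z 0)).hasDerivWithinAt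
      (s := Ici 0)
    refine this.congr (fun t ht => ?_) ?_
    · exact (heq ht).trans (hz.integral_eq t ht)
    · exact (heq (mem_Ici.2 le_rfl)).trans (by simp)
  -- The two expressions for the right derivative at $0$ are the two sides of the identity, tested
  -- on one coordinate vector.
  have := (uniqueDiffOn_Ici (0 : ℝ) 0 (mem_Ici.2 le_rfl)).eq_deriv _ hd1 hd2
  rw [hw0] at this
  rw [sub_mulVec, ← mulVec_mulVec, ← mulVec_mulVec, this, ← mulVec_mulVec,
    ← mulVec_mulVec, sub_eq_add_neg]
  simp only [hψ, hw0]

theorem pinv_mul_self {G : Matrix (Fin n) (Fin N) ℝ} (hG : G.rank = N) : pinv G * G = 1 := by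
  refine Matrix.ext_of_mulVec_single fun i => mulVec_injective_of_rank hG ?_
  rw [mulVec_mulVec, one_mulVec, ← Matrix.mul_assoc, (pinv_spec G).mul_mul_left]

/-- If the data are `ℓ`-detectable, then the state belonging to `Fᵀ ℓ` is stabilizable. -/
theorem IsAssociated.stateMap_mem (hS : IsAssociated F A H S) {ℓ : Fin m → ℝ}
    (hℓ : IsDetectable F A H ℓ) :
    S.stateMap F *ᵥ (Fᵀ *ᵥ ℓ) ∈ S.stabilizabilitySubspace ∧
      (Fᵀ * S.C.toRows₁) *ᵥ (S.stateMap F *ᵥ (Fᵀ *ᵥ ℓ)) = Fᵀ *ᵥ ℓ := by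
  obtain ⟨q, u, z, hz, hz0, hlim⟩ := hℓ
  obtain ⟨v, g, hvg, hout⟩ := (hS.behavior (Ici 0) (Or.inl rfl) q u).1 ⟨z, hz⟩
  have hvc := hvg.2.1.continuousOn
  have hcont : ContinuousOn (fun t => (Fᵀ * S.C.toRows₁) *ᵥ v t) (Ici 0) :=
    (show Continuous fun w : Fin N → ℝ => (Fᵀ * S.C.toRows₁) *ᵥ w by
      fun_prop).comp_continuousOn hvc
  have heq : EqOn z (fun t => (Fᵀ * S.C.toRows₁) *ᵥ v t) (Ici 0) := by
    refine eqOn_Ici_of_ae_eq hz.state.ac.continuousOn hcont ?_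
    filter_upwards [hout, hz.state.ae_eq] with t h1 h2
    have hq : q t = S.C.toRows₁ *ᵥ v t + S.D.toRows₁ *ᵥ g t := by
      funext i
      exact congrFun h1 (Sum.inl i)
    rw [← h2, hq, mulVec_add, mulVec_mulVec, mulVec_mulVec, hS.direct_eq, zero_mulVec, add_zero]
  -- The state map is a left inverse of $F^\top C_s$, so the state is recovered from $F^\top q$ and
  -- inherits its decay.
  have hv : EqOn (fun t => S.stateMap F *ᵥ z t) v (Ici 0) := by
    intro t ht
    simp only [heq ht, LTI.stateMap]
    rw [mulVec_mulVec, pinv_mul_self hS.state_rank, one_mulVec]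
  have hv0 := hv (mem_Ici.2 le_rfl)
  simp only [hz0] at hv0
  have hz0' := heq (mem_Ici.2 le_rfl)
  simp only [hz0] at hz0'
  rw [hv0]
  refine ⟨⟨v, g, hvg, rfl, ?_⟩, hz0'.symm⟩
  have h1 : Tendsto (fun t => S.stateMap F *ᵥ z t) atTop (𝓝 (S.stateMap F *ᵥ 0)) :=
    ((show Continuous fun w : Fin n → ℝ => S.stateMap F *ᵥ w by fun_prop).tendsto 0).comp hlim
  rw [mulVec_zero] at h1
  exact h1.congr' ((eventually_ge_atTop 0).mono fun t ht => hv ht)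

/-! ### The estimation error -/

theorem SolvesDAE.ae_hasDerivAt {a b : ℕ} {E M : Matrix (Fin a) (Fin b) ℝ} {x : ℝ → Fin b → ℝ}
    {w : ℝ → Fin a → ℝ} {z : ℝ → Fin a → ℝ} (h : SolvesDAE (Ici 0) E M x w z)
    (hx : L2Loc (Ici 0) x) (hw : L2Loc (Ici 0) w) :
    ∀ᵐ t ∂volume.restrict (Ici 0), HasDerivAt z (M *ᵥ x t + w t) t := by
  have h1 := ae_hasDerivAt_integral fun t ht => ((hx.mulVec M).add hw).intervalIntegrable ht
  rw [ae_restrict_iff' measurableSet_Ici] at h1 ⊢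
  filter_upwards [h1, Measure.ae_ne volume (0 : ℝ)] with t ht h0 ht0
  have hpos : 0 < t := lt_of_le_of_ne ht0 h0.symm
  exact ((ht ht0).const_add (z 0)).congr_of_eventuallyEq
    ((lt_mem_nhds hpos).mono fun s hs => h.integral_eq s hs.le)

/-- By continuity the representative stays in the range of $E$ at every time. Thus $\ell\cdot Fx(t)$
depends on $\ell$ only through $F^\top\ell$. -/
theorem SolvesDAE.dotProduct_eq_zero {a b : ℕ} {E M : Matrix (Fin a) (Fin b) ℝ}
    {x : ℝ → Fin b → ℝ} {w : ℝ → Fin a → ℝ} {z : ℝ → Fin a → ℝ} (h : SolvesDAE (Ici 0) E M x w z)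
    {ξ : Fin a → ℝ} (hξ : Eᵀ *ᵥ ξ = 0) {t : ℝ} (ht : 0 ≤ t) : ξ ⬝ᵥ z t = 0 := by
  have hc : ContinuousOn (fun t => fun _ : Fin 1 => ξ ⬝ᵥ z t) (Ici 0) :=
    (show Continuous fun w : Fin a → ℝ => fun _ : Fin 1 => ξ ⬝ᵥ w by
      fun_prop).comp_continuousOn h.ac.continuousOn
  refine congrFun (eqOn_Ici_of_ae_eq hc (w := fun _ _ => 0) continuousOn_const ?_ ht) 0
  filter_upwards [h.ae_eq] with t ht
  rw [← ht, dotProduct_mulVec_comm, hξ, zero_dotProduct]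

theorem estimationError_eq {Mg : Matrix (Fin l) (Fin n) ℝ} {K : Matrix (Fin k) (Fin l) ℝ}
    {ℓ : Fin m → ℝ}
    (hdual : Fᵀ * (closedLoopC Sg K).toRows₁ * closedLoopA Sg K =
      Aᵀ * (closedLoopC Sg K).toRows₁ - Hᵀ * (closedLoopC Sg K).toRows₂)
    (hinit : (Fᵀ * (closedLoopC Sg K).toRows₁) *ᵥ (Mg *ᵥ (Fᵀ *ᵥ ℓ)) = Fᵀ *ᵥ ℓ)
    {x : ℝ → Fin n → ℝ} {f : ℝ → Fin m → ℝ} {y η : ℝ → Fin p → ℝ} {Fx : ℝ → Fin m → ℝ}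
    (hx : IsSolution (Ici 0) F A H x f y η Fx) {r : ℝ → Fin l → ℝ}
    (hr : SolvesErrorEquation Sg K Fx f η r) {t : ℝ} (ht : 0 ≤ t) :
    estimationError ℓ (observer F Sg Mg K ℓ) Fx y t = (Mg *ᵥ (Fᵀ *ᵥ ℓ)) ⬝ᵥ r t := by
  set M := closedLoopA Sg K with hM
  set C := closedLoopC Sg K with hC
  set w₀ := Mg *ᵥ (Fᵀ *ᵥ ℓ) with hw₀
  have hCsum : ∀ (a : Fin m → ℝ) (b : Fin p → ℝ),
      Cᵀ *ᵥ Sum.elim a b = C.toRows₁ᵀ *ᵥ a + C.toRows₂ᵀ *ᵥ b := by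
    intro a b
    funext i
    simp [mulVec, dotProduct, Fintype.sum_sum_type]
  set d : ℝ → Fin l → ℝ := fun s => C.toRows₁ᵀ *ᵥ Fx s - r s with hd
  set π : ℝ → Fin l → ℝ := fun s => NormedSpace.exp ((t - s) • M) *ᵥ w₀ with hπ
  have hd0 : d 0 = 0 := by
    rw [hd]
    simp only [hr.2]
    rw [hCsum]
    simp
  have hdac : AbsolutelyContinuousOnInterval d 0 t :=
    (ac_mulVec _ (hx.state.ac 0 t ht Icc_subset_Ici_self)).sub
      (hr.1.1 0 t ht Icc_subset_Ici_self)
  have hdd : ∀ᵐ s ∂volume.restrict (Ici 0),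
      HasDerivAt d (Mᵀ *ᵥ d s + C.toRows₂ᵀ *ᵥ y s) s := by
    filter_upwards [hx.state.ae_hasDerivAt hx.l2_x hx.l2_f, hr.1.2, hx.output, hx.state.ae_eq]
      with s h1 h2 h3 h4
    refine ((hasDerivAt_const_mulVec C.toRows₁ᵀ h1).fun_sub h2).congr_deriv ?_
    -- The transposed duality identity turns the unknown $Ax$ into a function of $Fx$ and $Hx$; $f$
    -- then cancels against the forcing of $\tilde r$, and $Hx+\eta$ becomes $y$.
    have e : C.toRows₁ᵀ *ᵥ (A *ᵥ x s) =
        Mᵀ *ᵥ (C.toRows₁ᵀ *ᵥ (F *ᵥ x s)) + C.toRows₂ᵀ *ᵥ (H *ᵥ x s) := by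
      have := congrArg (fun Z => Zᵀ *ᵥ x s) hdual
      simp only [transpose_mul, transpose_sub, transpose_transpose, sub_mulVec,
        ← mulVec_mulVec] at this
      rw [this, sub_add_cancel]
    rw [← hC, hCsum, hd, ← hM]
    simp only [mulVec_sub, mulVec_add, mulVec_neg, h3, e, ← h4]
    abel
  have hπd : ∀ s, HasDerivAt π (-(M *ᵥ π s)) s := fun s => by
    have := (hasDerivAt_exp_mulVec M w₀ (t - s)).scomp s ((hasDerivAt_id s).const_sub t)
    exact this.congr_deriv (by rw [neg_one_smul])
  have hπac : AbsolutelyContinuousOnInterval π 0 t :=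
    ContDiffOn.absolutelyContinuousOnInterval
      ((contDiff_exp_mulVec M w₀).comp (contDiff_const.sub contDiff_id)).contDiffOn
  -- The backward flow $\pi$ is adjoint to the equation of $d$, so the derivative of $\pi\cdot d$
  -- contains only the term in $y$, which is the observer's integrand.
  obtain ⟨-, hint⟩ := integral_eq_sub_of_ac ht (ac_dotProduct hπac hdac)
    (ψ := fun s => y s ⬝ᵥ observer F Sg Mg K ℓ t s) (by
      filter_upwards [hdd] with s hs
      convert hasDerivAt_dotProduct (hπd s) hs using 1
      have e : observer F Sg Mg K ℓ t s = C.toRows₂ *ᵥ π s := rfl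
      rw [e, dotProduct_add, dotProduct_mulVec_comm Mᵀ, transpose_transpose, neg_dotProduct,
        neg_add_cancel_left, dotProduct_mulVec_comm C.toRows₂ᵀ, transpose_transpose,
        dotProduct_comm])
  have hπt : π t = w₀ := by simp [hπ]
  rw [hd0, dotProduct_zero, sub_zero, hπt] at hint
  have hz : w₀ ⬝ᵥ C.toRows₁ᵀ *ᵥ Fx t = ℓ ⬝ᵥ Fx t := by
    rw [dotProduct_mulVec_comm, transpose_transpose, ← sub_eq_zero, ← sub_dotProduct]
    refine hx.state.dotProduct_eq_zero ?_ ht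
    rw [mulVec_sub, mulVec_mulVec, hinit, sub_self]
  rw [estimationError, observerOutput, hint, hd]
  simp only [dotProduct_sub, hz, sub_sub_cancel]

end

/-! ### The combined disturbance and the assembly of the theorem -/

theorem memLp_elim {m p : ℕ} {μ : Measure ℝ} {f : ℝ → Fin m → ℝ} {η : ℝ → Fin p → ℝ}
    (hf : MemLp f 2 μ) (hη : MemLp η 2 μ) : MemLp (fun t => Sum.elim (f t) (-η t)) 2 μ := by
  rw [memLp_pi_iff] at hf hη ⊢
  rintro (i | i)
  · exact hf i
  · exact (hη i).neg

theorem elim_dotProduct_self {m p : ℕ} (a : Fin m → ℝ) (b : Fin p → ℝ) :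
    Sum.elim a (-b) ⬝ᵥ Sum.elim a (-b) = a ⬝ᵥ a + b ⬝ᵥ b := by
  simp [dotProduct, Fintype.sum_sum_type]

end DAEObserver

end

open DAEObserver in
theorem lemma1 {m n p k l : ℕ}
    (F A : Matrix (Fin m) (Fin n) ℝ) (H : Matrix (Fin p) (Fin n) ℝ)
    (Q : Matrix (Fin m) (Fin m) ℝ) (R : Matrix (Fin p) (Fin p) ℝ)
    (hQ : Q.PosDef) (hR : R.PosDef)
    (ℓ : Fin m → ℝ) (hℓ : IsDetectable F A H ℓ)
    (Sg : LTI l k m p) (Mg : Matrix (Fin l) (Fin n) ℝ)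
    (hSg : IsStabilizableAssociated F A H Sg Mg)
    (P : Matrix (Fin l) (Fin l) ℝ) (hP : P.PosDef) (hARE : SolvesARE Sg Q R P)
    (K : Matrix (Fin k) (Fin l) ℝ) (hK : K = gain Sg Q R P) :
    IsHurwitz (closedLoopA Sg K)ᵀ ∧
    ∀ (x : ℝ → Fin n → ℝ) (f : ℝ → Fin m → ℝ) (y η : ℝ → Fin p → ℝ) (Fx : ℝ → Fin m → ℝ),
      IsSolution (Ici 0) F A H x f y η Fx →
      ∀ e : ℝ → ℝ, e = estimationError ℓ (observer F Sg Mg K ℓ) Fx y →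
        (∃ r, SolvesErrorEquation Sg K Fx f η r) ∧
        (∀ r, SolvesErrorEquation Sg K Fx f η r →
          ∀ t, 0 ≤ t → e t = (ℓ ᵥ* (F * Mgᵀ)) ⬝ᵥ r t) ∧
        ((∀ᵐ t ∂volume.restrict (Ici 0), f t = 0 ∧ η t = 0) → Tendsto e atTop (𝓝 0)) ∧
        ((∃ c : ℝ, ∀ᵐ t ∂volume.restrict (Ici 0), f t ⬝ᵥ f t ≤ c ∧ η t ⬝ᵥ η t ≤ c) →
          ∃ C : ℝ, ∀ t, 0 ≤ t → e t ^ 2 ≤ C) ∧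
        (MemLp f 2 (volume.restrict (Ici 0)) → MemLp η 2 (volume.restrict (Ici 0)) →
          MemLp e 2 (volume.restrict (Ici 0))) := by
  obtain ⟨N, r, S, T, T', hS, hT, rfl, rfl⟩ := hSg
  have hres := hT.isRestriction
  set Sg := S.restrict T T' with hSg
  set Mg := (T * S.stateMap F).toRows₁ with hMg
  have hJ : Function.Injective T'.toCols₁.mulVec := fun v w hvw => by
    have := congrArg (fun z => T.toRows₁ *ᵥ z) hvw
    simpa [mulVec_mulVec, hT.toRows₁_mul_toCols₁] using this
  have hD : Sg.D = 0 ∨ Sg.D.rank = k := hS.input_rank.imp (fun h => h.2.1) id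
  have hC := hres.closedLoopC_injective hS hJ K
  have hdual := hres.closedLoop_dual_eq hS K
  have hLyap : IsLyapunov P⁻¹ (closedLoopA Sg K)ᵀ := by
    refine isLyapunov_of_lyapunov_eq hP (weight_posDef hQ hR) hC ?_
    rw [hK]
    exact closedLoop_lyapunov_eq hQ hR hD hP hARE
  have hinit : (Fᵀ * (closedLoopC Sg K).toRows₁) *ᵥ (Mg *ᵥ (Fᵀ *ᵥ ℓ)) = Fᵀ *ᵥ ℓ := by
    obtain ⟨h1, h2⟩ := hS.stateMap_mem hℓ
    have e : Mg *ᵥ (Fᵀ *ᵥ ℓ) = T.toRows₁ *ᵥ (S.stateMap F *ᵥ (Fᵀ *ᵥ ℓ)) := by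
      rw [mulVec_mulVec _ T.toRows₁]
      rfl
    rw [e, hres.mul_closedLoopC hS, ← mulVec_mulVec _ _ T'.toCols₁,
      hT.toCols₁_mulVec_toRows₁_mulVec h1, h2]
  refine ⟨hLyap.isHurwitz, fun x f y η Fx hx e he => ?_⟩
  set b : ℝ → Fin l → ℝ := fun t => (closedLoopC Sg K)ᵀ *ᵥ Sum.elim (f t) (-η t) with hb
  have hbl : L2Loc (Ici 0) b := fun a c hac =>
    memLp_mulVec _ (memLp_elim (hx.l2_f a c hac) (hx.l2_η a c hac))
  set w := Mg *ᵥ (Fᵀ *ᵥ ℓ) with hw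
  have hrep : ∀ r, SolvesErrorEquation Sg K Fx f η r → ∀ t, 0 ≤ t → e t = w ⬝ᵥ r t :=
    fun r hr t ht => he ▸ estimationError_eq hdual hinit hx hr ht
  have hw' : ℓ ᵥ* (F * Mgᵀ) = w := by
    rw [← mulVec_transpose, transpose_mul, transpose_transpose, hw, mulVec_mulVec]
  have hex : ∃ r, SolvesErrorEquation Sg K Fx f η r :=
    ⟨_, solvesODE_variationOfConstants _ (fun _ ht => hbl.intervalIntegrable ht) _,
      variationOfConstants_zero _ _ _⟩
  obtain ⟨ρ, hρ⟩ := hex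
  refine ⟨⟨ρ, hρ⟩, by rwa [hw'], fun h0 => ?_, fun ⟨c, hc⟩ => ?_, fun hf hη => ?_⟩
  · refine (hLyap.tendsto_dotProduct w hbl hρ.1 ?_).congr'
      ((eventually_ge_atTop 0).mono fun t ht => (hrep ρ hρ t ht).symm)
    filter_upwards [h0] with t ht
    have : Sum.elim (f t) (-η t) = 0 := by
      rw [ht.1, ht.2]
      funext i
      rcases i with i | i <;> simp
    rw [hb]
    simp only [this, mulVec_zero]
  · obtain ⟨κ, hκ, hκ'⟩ := exists_mulVec_dotProduct_self_le (closedLoopC Sg K)ᵀ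
    -- The forcing is a matrix applied to $(f,-\eta)$: $\kappa$ bounds that matrix and $c+c$ bounds
    -- $|f|^2+|\eta|^2$.
    obtain ⟨C, hC'⟩ := hLyap.exists_bound_dotProduct w hbl hρ.1 (β := κ * (c + c)) (by
      filter_upwards [hc] with t ht
      refine (hκ' _).trans (mul_le_mul_of_nonneg_left ?_ hκ.le)
      rw [elim_dotProduct_self]
      exact add_le_add ht.1 ht.2)
    exact ⟨C, fun t ht => by rw [hrep ρ hρ t ht]; exact hC' t ht⟩
  · refine (memLp_congr_ae ?_).1
      (hLyap.memLp_dotProduct w hbl hρ.1 (memLp_mulVec _ (memLp_elim hf hη)))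
    rw [EventuallyEq, ae_restrict_iff' measurableSet_Ici]
    exact ae_of_all _ fun t ht => (hrep ρ hρ t ht).symm
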